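/- For $T\in[0,1[$ let $\rho(T)$ be the unique $\rho\in\,]0,+\infty[$ such that $\big(\frac{\rho}{1-T}\big)^{1-T}\big(\frac{\rho+2}{1+T}\big)^{1+T}=1$, and let $r(T):=1+\rho(T)$. For an open set $U\subset\mathbb C^\mu$ let $H(U)$ be the space of holomorphic functions on $U$ with the topology of uniform convergence on compact subsets. Let $m\ge 1$, let $\mathbf R$ be a metric space, let $T_1,\dots,T_m\in[0,1[$, and let $\phi:(a,x)\mapsto\phi(a,x)\in\mathbb C$ be a continuous function on $\big(\prod_{j=1}^m\,]-r(T_j),r(T_j)[\big)\times\mathbf R$. Suppose that for each pair of disjoint subsets $J^-,J^+$ of $\{1,\dots,m\}$ with $J:=J^-\cup J^+\neq\emptyset$ and $J':=\{1,\dots,m\}\setminus J$ there is a continuous map $$(\alpha,x)\in[-1,1]^{J'}\times\mathbf R\longmapsto f_{\alpha,x}=f_{(J^-,J^+),\alpha,x}\in H\big(\{w\in\mathbb C^{J}:|w_j|<r(T_j)\ \text{for all } j\in J\}\big)$$ such that, for every $x\in\mathbf R$ and every $a\in\prod_{j=1}^m\,]-r(T_j),r(T_j)[$ with $a_j\le -T_j$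 for $j\in J^-$, $a_j\ge T_j$ for $j\in J^+$ and $a_j\in[-1,1]$ for $j\in J'$, one has $\phi(a,x)=f_{a_{J'},x}(a_J)$, where $a_J=(a_j)_{j\in J}$ and $a_{J'}=(a_j)_{j\in J'}$. Then $$\lim_{\min_j N_j\to+\infty}\ \sum_{\nu_1=0}^{N_1}\cdots\sum_{\nu_m=0}^{N_m}\ \prod_{j=1}^m\binom{N_j}{\nu_j}\Big(\frac{1-a_j}{2}\Big)^{\nu_j}\Big(\frac{1+a_j}{2}\Big)^{N_j-\nu_j}\ \phi\Big(1-\frac{2\nu_1}{N_1},\dots,1-\frac{2\nu_m}{N_m},\,x\Big)=\phi(a,x)$$ uniformly in $(a,x)$ on every compact subset of $\big(\prod_{j=1}^m\,]-r(T_j),r(T_j)[\big)\times\mathbf R$, where $N=(N_1,\dots,N_m)$ ranges over the $m$-tuples of positive integers. -/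

import Mathlib

open Set Filter Topology

noncomputable section

namespace BernsteinPoly

/-- The function `ρ ↦ (ρ / (1 - T)) ^ (1 - T) * ((ρ + 2) / (1 + T)) ^ (1 + T) - 1`. -/
def lemniscateFun (T ρ : ℝ) : ℝ :=
  (ρ / (1 - T)) ^ (1 - T) * ((ρ + 2) / (1 + T)) ^ (1 + T) - 1

/-- The positive root `ρ(T)` of `lemniscateFun T`; by `existsUnique_root` below the set is a
singleton for `T ∈ [0, 1[`. -/
def rho (T : ℝ) : ℝ := sInf {ρ : ℝ | 0 < ρ ∧ lemniscateFun T ρ = 0}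

/-- The radius `r(T) = 1 + ρ(T)`. -/
def radius (T : ℝ) : ℝ := 1 + rho T

theorem lemniscateFun_strictMonoOn {T : ℝ} (hT : T ∈ Ico (0 : ℝ) 1) :
    StrictMonoOn (lemniscateFun T) (Ici 0) := by
  intro a ha b hb hab
  have h1 : 0 < 1 - T := by linarith [hT.2]
  have h2 : 0 < 1 + T := by linarith [hT.1]
  have ha' : (0 : ℝ) ≤ a := ha
  have e1 : (a / (1 - T)) ^ (1 - T) < (b / (1 - T)) ^ (1 - T) :=
    Real.rpow_lt_rpow (by positivity) (by gcongr) h1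
  have e2 : ((a + 2) / (1 + T)) ^ (1 + T) < ((b + 2) / (1 + T)) ^ (1 + T) :=
    Real.rpow_lt_rpow (by positivity) (by gcongr) h2
  have e3 : 0 ≤ (a / (1 - T)) ^ (1 - T) := by positivity
  have e4 : 0 ≤ ((a + 2) / (1 + T)) ^ (1 + T) := by positivity
  have := mul_lt_mul'' e1 e2 e3 e4
  unfold lemniscateFun
  linarith

theorem existsUnique_root {T : ℝ} (hT : T ∈ Ico (0 : ℝ) 1) :
    ∃! ρ : ℝ, 0 < ρ ∧ lemniscateFun T ρ = 0 := by
  have h1 : 0 < 1 - T := by linarith [hT.2]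
  have h2 : 0 < 1 + T := by linarith [hT.1]
  have hc : ContinuousOn (lemniscateFun T) (Icc 0 2) := by
    unfold lemniscateFun
    refine ContinuousOn.sub (ContinuousOn.mul ?_ ?_) continuousOn_const
    · exact ContinuousOn.rpow_const (by fun_prop) (fun _ _ => Or.inr h1.le)
    · exact ContinuousOn.rpow_const (by fun_prop) (fun _ _ => Or.inr h2.le)
  have h0 : lemniscateFun T 0 = -1 := by
    simp [lemniscateFun, Real.zero_rpow h1.ne']
  have e1 : 1 < (2 / (1 - T)) ^ (1 - T) :=
    Real.one_lt_rpow (by rw [one_lt_div h1]; linarith [hT.1]) h1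
  have e2 : 1 < ((2 + 2) / (1 + T)) ^ (1 + T) :=
    Real.one_lt_rpow (by rw [one_lt_div h2]; linarith [hT.2]) h2
  have h3 : 0 < lemniscateFun T 2 := by
    unfold lemniscateFun
    nlinarith
  obtain ⟨ρ, hρ, hρ0⟩ : (0 : ℝ) ∈ lemniscateFun T '' Icc 0 2 :=
    intermediate_value_Icc (by norm_num) hc ⟨by rw [h0]; norm_num, h3.le⟩
  have hpos : 0 < ρ := by
    rcases hρ.1.lt_or_eq with h | h
    · exact h
    · rw [← h, h0] at hρ0
      norm_num at hρ0
  refine ⟨ρ, ⟨hpos, hρ0⟩, ?_⟩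
  rintro σ ⟨hσ, hσ0⟩
  exact (lemniscateFun_strictMonoOn hT).injOn hσ.le hpos.le (hσ0.trans hρ0.symm)

theorem rho_spec {T : ℝ} (hT : T ∈ Ico (0 : ℝ) 1) :
    0 < rho T ∧ lemniscateFun T (rho T) = 0 := by
  obtain ⟨ρ, hρ, hu⟩ := existsUnique_root hT
  have hs : {ρ : ℝ | 0 < ρ ∧ lemniscateFun T ρ = 0} = {ρ} :=
    Set.eq_singleton_iff_unique_mem.2 ⟨hρ, hu⟩
  have : rho T = ρ := by rw [rho, hs, csInf_singleton]
  rwa [this]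

/-- The open box `∏ j, ]-s j, s j[` in `ℝ ^ ι`. -/
def box {ι : Type*} (s : ι → ℝ) : Set (ι → ℝ) := {a | ∀ j, a j ∈ Ioo (-s j) (s j)}

/-- The open polydisc `{w | |w j| < s j for all j}` in `ℂ ^ ι`. -/
def polydisc {ι : Type*} (s : ι → ℝ) : Set (ι → ℂ) := {w | ∀ j, ‖w j‖ < s j}

/-- The complex point with coordinates `a j`, `j ∈ J`, for `a` in the real box. -/
def restrictBox {ι : Type*} {s : ι → ℝ} (J : Finset ι) (a : ι → ℝ) (ha : a ∈ box s) :
    polydisc (fun j : J => s j) :=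
  ⟨fun j => (a j : ℂ), fun j => by
    rw [Complex.norm_real, Real.norm_eq_abs]
    exact abs_lt.2 (ha j)⟩

/-- The space `H(U)` of holomorphic functions on an open set `U ⊆ ℂ ^ ι`, as a subset of `C(U, ℂ)`.
Its topology is the one induced by the compact-open topology of `C(U, ℂ)`, that is, the topology of
uniform convergence on the compact subsets of `U`. -/
def Hol {ι : Type*} [Fintype ι] (U : Set (ι → ℂ)) : Set C(U, ℂ) :=
  {f | ∃ g : (ι → ℂ) → ℂ, DifferentiableOn ℂ g U ∧ ∀ w : U, f w = g w}

/-- The multivariate Bernstein sum of `φ` at `(a, x)`, with nodes `1 - 2 ν / N`, `0 ≤ ν j ≤ N j`. -/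
def bernsteinSum {m : ℕ} {R : Type*} (φ : (Fin m → ℝ) × R → ℂ) (N : Fin m → ℕ+)
    (p : (Fin m → ℝ) × R) : ℂ :=
  ∑ ν ∈ Fintype.piFinset (fun j => Finset.range ((N j : ℕ) + 1)),
    ((∏ j, ((N j : ℕ).choose (ν j) : ℝ) * ((1 - p.1 j) / 2) ^ ν j *
        ((1 + p.1 j) / 2) ^ ((N j : ℕ) - ν j) : ℝ) : ℂ) *
      φ (fun j => 1 - 2 * ((ν j : ℝ) / (N j : ℕ)), p.2)

/-- The filter `min (N 1, ..., N m) → +∞` on tuples of positive integers (for `m ≥ 1`). -/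
def minAtTop (m : ℕ) : Filter (Fin m → ℕ+) :=
  comap (fun N => ⨅ j, (N j : ℕ)) atTop

end BernsteinPoly

end

/-! In one variable, let `a` lie in $[1,r(T)[$, and let `h` be the holomorphic function on the disc
that agrees with φ on the nodes `≥ T`. Two facts suffice. First, the full Bernstein sum of `h`
converges to `h a`: the error on $z^k$ is at most $2R^k k^2/N$ for $|a|\le R$, and Cauchy estimates
make the power series of `h` absorb it (`exists_norm_bernsteinApply_sub_le`). Second, the nodes `<
T`, where φ and `h` may differ, have total absolute weight tending to 0 geometrically
(`exists_sum_abs_weight_le`). This is a Chernoff bound, and the equation defining $\rho(T)$ is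
exactly the threshold at which its optimal rate reaches 1. Points `a ≤ -1` follow by reflection; on
$[-1,1]$ the weights are positive and Bernstein's classical argument applies.

In several variables, fix the set of coordinates of `a` below -1 and the set of those above 1. Call
a node coordinate bad if it lies on the wrong side of the threshold, and split the sum according to
the set `S` of bad coordinates (`bernsteinSum_eq_sum_partialSum`). On each piece φ may be replaced
by the extension that is holomorphic only in the exterior coordinates outside `S`. Each piece is
then a tensor product of one-variable functionals. If `S` is nonempty, one factor is small and the
others are bounded (`eventually_norm_partialSum_le`); if `S` is empty, every factor is close to
evaluation (`eventually_norm_partialSum_empty_sub_le`). -/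

noncomputable section

namespace BernsteinPoly

/-! ### Moments of the Bernstein weights at real points, possibly outside [-1, 1] -/

/-- The Bernstein weight of the node `1 - 2 ν / N` at the point `a`. -/
def weight (N : ℕ) (a : ℝ) (ν : ℕ) : ℝ :=
  (N.choose ν : ℝ) * ((1 - a) / 2) ^ ν * ((1 + a) / 2) ^ (N - ν)

/-- The Bernstein node `1 - 2 ν / N`. -/
def node (N ν : ℕ) : ℝ := 1 - 2 * ((ν : ℝ) / N)

theorem node_mem_Icc {N ν : ℕ} (hν : ν ∈ Finset.range (N + 1)) : node N ν ∈ Icc (-1 : ℝ) 1 := by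
  have h : (ν : ℝ) ≤ N := by exact_mod_cast Nat.lt_succ_iff.1 (Finset.mem_range.1 hν)
  have h1 : (ν : ℝ) / N ≤ 1 := div_le_one_of_le₀ h (by positivity)
  have h0 : 0 ≤ (ν : ℝ) / N := by positivity
  unfold node
  constructor <;> linarith

/-- Pascal's rule, read as conditioning on one step of a walk: `N - 2ν` is the sum of `N` steps ±1
of (possibly signed) weights `(1 ± a) / 2`, and `ν` counts the steps -1. -/
theorem sum_weight_succ (N : ℕ) (a : ℝ) (h : ℝ → ℝ) :
    ∑ ν ∈ Finset.range (N + 2), weight (N + 1) a ν * h (((N + 1 : ℕ) : ℝ) - 2 * ν) =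
      (1 + a) / 2 * ∑ ν ∈ Finset.range (N + 1), weight N a ν * h (((N : ℝ) - 2 * ν) + 1) +
      (1 - a) / 2 * ∑ ν ∈ Finset.range (N + 1), weight N a ν * h (((N : ℝ) - 2 * ν) + -1) := by
  have key := Finset.sum_choose_succ_mul
    (fun i j => ((1 - a) / 2) ^ i * ((1 + a) / 2) ^ j * h (((N + 1 : ℕ) : ℝ) - 2 * i)) N
  simp only [weight, mul_assoc] at key ⊢
  rw [key, Finset.mul_sum, Finset.mul_sum]
  congr 1
  · refine Finset.sum_congr rfl fun i hi => ?_
    have : N + 1 - i = (N - i) + 1 := by have := Finset.mem_range.1 hi; omega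
    rw [this, pow_succ]
    push_cast
    ring_nf
  · refine Finset.sum_congr rfl fun i hi => ?_
    rw [pow_succ]
    push_cast
    ring_nf

/-- The unnormalised moments of the Bernstein weights. -/
def moment (N : ℕ) (a : ℝ) (k : ℕ) : ℝ :=
  ∑ ν ∈ Finset.range (N + 1), weight N a ν * ((N : ℝ) - 2 * ν) ^ k

/-- The moments of a signed coin toss of mean `a`. -/
def coinMoment (a : ℝ) (l : ℕ) : ℝ := (1 + a) / 2 + (1 - a) / 2 * (-1) ^ l

theorem moment_zero (a : ℝ) (k : ℕ) : moment 0 a k = 0 ^ k := by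
  simp [moment, weight]

theorem moment_succ (N : ℕ) (a : ℝ) (k : ℕ) :
    moment (N + 1) a k =
      ∑ i ∈ Finset.range (k + 1), moment N a i * coinMoment a (k - i) * (k.choose i : ℝ) := by
  rw [moment, sum_weight_succ N a (fun t => t ^ k)]
  simp only [add_pow, moment, coinMoment, Finset.mul_sum, Finset.sum_mul, one_pow]
  rw [Finset.sum_comm, Finset.sum_comm (s := Finset.range (N + 1)), ← Finset.sum_add_distrib]
  refine Finset.sum_congr rfl fun i _ => ?_
  rw [← Finset.sum_add_distrib]
  exact Finset.sum_congr rfl fun ν _ => by ring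

theorem abs_coinMoment_le {a R : ℝ} (hR : 1 ≤ R) (ha : |a| ≤ R) (l : ℕ) :
    |coinMoment a l| ≤ R ^ l := by
  rcases Nat.even_or_odd l with h | h
  · have : coinMoment a l = 1 := by rw [coinMoment, h.neg_one_pow]; ring
    rw [this, abs_one]
    exact one_le_pow₀ hR
  · have : coinMoment a l = a := by rw [coinMoment, h.neg_one_pow]; ring
    rw [this]
    exact ha.trans (le_self_pow₀ hR h.pos.ne')

theorem abs_moment_le {a R : ℝ} (hR : 1 ≤ R) (ha : |a| ≤ R) (N k : ℕ) :
    |moment N a k| ≤ (N * R) ^ k := by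
  induction N generalizing k with
  | zero => rw [moment_zero]; simp
  | succ N ih =>
    rw [moment_succ]
    push_cast
    rw [add_mul, one_mul, add_pow]
    refine (Finset.abs_sum_le_sum_abs _ _).trans (Finset.sum_le_sum fun i _ => ?_)
    rw [abs_mul, abs_mul, Nat.abs_cast]
    gcongr
    · exact ih i
    · exact abs_coinMoment_le hR ha _

theorem cast_succ_descFactorial_succ (n k : ℕ) :
    (((n + 1).descFactorial (k + 1) : ℕ) : ℝ) =
      n.descFactorial (k + 1) + (k + 1) * n.descFactorial k := by
  rw [Nat.succ_descFactorial_succ, Nat.descFactorial_succ]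
  rcases le_or_gt k n with h | h
  · push_cast [Nat.cast_sub h]; ring
  · rw [Nat.descFactorial_eq_zero_iff_lt.2 h]; simp

/-- Heuristically, expand the `k`-th power of a sum of `N` independent steps over `k`-tuples of
indices. Tuples without repetition contribute $a^k$ to both sides and cancel; the remaining `N ^ k -
N.descFactorial k` tuples contribute at most $R^k$ to each side. The induction on `N` implements
this count. -/
theorem abs_moment_sub_le {a R : ℝ} (hR : 1 ≤ R) (ha : |a| ≤ R) (N k : ℕ) :
    |moment N a k - (N * a) ^ k| ≤ 2 * R ^ k * ((N : ℝ) ^ k - N.descFactorial k) := by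
  induction N generalizing k with
  | zero =>
    rw [moment_zero]
    rcases k with _ | k <;> simp
  | succ N ih =>
    rcases k with _ | k
    · have := ih 0
      rw [moment_succ]
      simpa [coinMoment, ← add_div] using this
    have hR0 : 0 ≤ R := by linarith
    have c0 : coinMoment a 0 = 1 := by simp [coinMoment]; ring
    have c1 : coinMoment a 1 = a := by simp [coinMoment]; ring
    have e1 : moment (N + 1) a (k + 1) = ∑ i ∈ Finset.range k,
        moment N a i * coinMoment a (k + 1 - i) * ((k + 1).choose i : ℝ) +
        moment N a k * a * (k + 1) + moment N a (k + 1) := by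
      rw [moment_succ, Finset.sum_range_succ, Finset.sum_range_succ]
      simp [c0, c1]
    -- The top two terms are isolated because coin moments 0 and 1 equal $a^0$ and $a^1$: there the
    -- error is inherited from `N`. All lower terms are bounded crudely.
    have split : ∀ u v : ℝ, (u + v) ^ (k + 1) = ∑ i ∈ Finset.range k,
        u ^ i * v ^ (k + 1 - i) * ((k + 1).choose i : ℝ) + u ^ k * v * (k + 1) + u ^ (k + 1) := by
      intro u v
      rw [add_pow, Finset.sum_range_succ, Finset.sum_range_succ]
      simp
    have e2 : ((N + 1 : ℕ) : ℝ) * a = N * a + a := by push_cast; ring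
    have e3 : ((N + 1 : ℕ) : ℝ) = N + 1 := by push_cast; ring
    have hs : |∑ i ∈ Finset.range k,
        moment N a i * coinMoment a (k + 1 - i) * ((k + 1).choose i : ℝ) - ∑ i ∈ Finset.range k,
        (N * a) ^ i * a ^ (k + 1 - i) * ((k + 1).choose i : ℝ)| ≤
        2 * R ^ (k + 1) * ∑ i ∈ Finset.range k,
        (N : ℝ) ^ i * 1 ^ (k + 1 - i) * ((k + 1).choose i : ℝ) := by
      rw [← Finset.sum_sub_distrib, Finset.mul_sum]
      refine (Finset.abs_sum_le_sum_abs _ _).trans (Finset.sum_le_sum fun i hi => ?_)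
      have hi' : R ^ (k + 1) = R ^ i * R ^ (k + 1 - i) := by
        rw [← pow_add]; congr 1; have := Finset.mem_range.1 hi; omega
      have b1 : |moment N a i * coinMoment a (k + 1 - i)| ≤ (N * R) ^ i * R ^ (k + 1 - i) := by
        rw [abs_mul]
        gcongr
        · exact abs_moment_le hR ha N i
        · exact abs_coinMoment_le hR ha _
      have b2 : |(N * a) ^ i * a ^ (k + 1 - i)| ≤ (N * R) ^ i * R ^ (k + 1 - i) := by
        rw [abs_mul, abs_pow, abs_pow, abs_mul, Nat.abs_cast]
        gcongr
      rw [← sub_mul, abs_mul, Nat.abs_cast, ← mul_assoc]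
      gcongr
      refine (abs_sub _ _).trans ((add_le_add b1 b2).trans (le_of_eq ?_))
      rw [hi', mul_pow]
      ring
    have h1 := ih (k + 1)
    have h2 : |moment N a k * a * (k + 1) - (N * a) ^ k * a * (k + 1)| ≤
        2 * R ^ (k + 1) * (((N : ℝ) ^ k - N.descFactorial k) * (k + 1)) := by
      rw [← sub_mul, ← sub_mul, abs_mul, abs_mul, abs_of_nonneg (by positivity : (0 : ℝ) ≤ k + 1)]
      calc _ ≤ (2 * R ^ k * ((N : ℝ) ^ k - N.descFactorial k)) * R * (k + 1) := by
            gcongr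
            · exact (abs_nonneg _).trans (ih k)
            · exact ih k
        _ = _ := by ring
    rw [e1, e2, cast_succ_descFactorial_succ, e3, split, split]
    have tri : ∀ x y z x' y' z' : ℝ, |x + y + z - (x' + y' + z')| ≤
        |x - x'| + |y - y'| + |z - z'| := by
      intro x y z x' y' z'
      rw [show x + y + z - (x' + y' + z') = (x - x') + (y - y') + (z - z') by ring]
      exact abs_add_three _ _ _
    refine (tri _ _ _ _ _ _).trans ((add_le_add (add_le_add hs h2) h1).trans (le_of_eq ?_))
    ring

/-- For `k ≤ N` this is Bernoulli's inequality applied to $(1-k/N)^k$; for `k > N` the factor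
$k^2/N$ already exceeds 1. -/
theorem pow_sub_descFactorial_le (N k : ℕ) (hN : 0 < N) :
    (N : ℝ) ^ k - N.descFactorial k ≤ k ^ 2 / N * N ^ k := by
  have hN' : (0 : ℝ) < N := by exact_mod_cast hN
  rcases le_or_gt k N with h | h
  · have h1 : ((N : ℝ) - k) ^ k ≤ N.descFactorial k := by
      have := Nat.pow_sub_le_descFactorial N k
      have h2 : (N - k) ^ k ≤ N.descFactorial k :=
        (Nat.pow_le_pow_left (by omega) k).trans this
      have h3 : (((N - k) ^ k : ℕ) : ℝ) ≤ N.descFactorial k := by exact_mod_cast h2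
      rwa [Nat.cast_pow, Nat.cast_sub h] at h3
    have h4 : (k : ℝ) / N ≤ 1 := div_le_one_of_le₀ (by exact_mod_cast h) hN'.le
    have h2 := one_add_mul_le_pow (a := -((k : ℝ) / N)) (by linarith) k
    have h3 : ((N : ℝ) - k) ^ k = (1 + -((k : ℝ) / N)) ^ k * N ^ k := by
      rw [← mul_pow]; congr 1; field_simp; ring
    have h5 : (1 + k * -((k : ℝ) / N)) * N ^ k ≤ ((N : ℝ) - k) ^ k := by
      rw [h3]; gcongr
    have h6 : (1 + k * -((k : ℝ) / N)) * (N : ℝ) ^ k = N ^ k - k ^ 2 / N * N ^ k := by ring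
    linarith
  · have h1 : (1 : ℝ) ≤ k ^ 2 / N := by
      rw [one_le_div hN']
      have h2 : (N : ℝ) ≤ k := by exact_mod_cast h.le
      have h3 : (1 : ℝ) ≤ k := by exact_mod_cast (by omega : 1 ≤ k)
      nlinarith
    have h2 : (0 : ℝ) ≤ N.descFactorial k := by positivity
    have h3 : (1 : ℝ) * N ^ k ≤ k ^ 2 / N * N ^ k := by gcongr
    linarith

theorem sum_weight_mul_node_pow {N : ℕ} (hN : 0 < N) (a : ℝ) (k : ℕ) :
    ∑ ν ∈ Finset.range (N + 1), weight N a ν * node N ν ^ k = moment N a k / N ^ k := by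
  have hN' : (N : ℝ) ≠ 0 := by positivity
  rw [moment, Finset.sum_div]
  refine Finset.sum_congr rfl fun ν _ => ?_
  rw [mul_div_assoc, ← div_pow, node]
  congr 2
  field_simp

theorem abs_sum_weight_mul_node_pow_sub_le {a R : ℝ} (hR : 1 ≤ R) (ha : |a| ≤ R) {N : ℕ}
    (hN : 0 < N) (k : ℕ) :
    |∑ ν ∈ Finset.range (N + 1), weight N a ν * node N ν ^ k - a ^ k| ≤
      2 * R ^ k * (k ^ 2 / N) := by
  have hN' : (0 : ℝ) < N := by positivity
  have : moment N a k / N ^ k - a ^ k = (moment N a k - (N * a) ^ k) / N ^ k := by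
    rw [mul_pow]; field_simp
  rw [sum_weight_mul_node_pow hN, this, abs_div, abs_pow, Nat.abs_cast,
    div_le_iff₀ (by positivity)]
  refine (abs_moment_sub_le hR ha N k).trans ?_
  rw [mul_assoc _ _ ((N : ℝ) ^ k)]
  gcongr
  exact pow_sub_descFactorial_le N k hN

/-! ### Positivity and variance on [-1, 1] -/

theorem weight_nonneg {a : ℝ} (ha : a ∈ Icc (-1 : ℝ) 1) (N ν : ℕ) : 0 ≤ weight N a ν := by
  have h1 : 0 ≤ (1 - a) / 2 := by linarith [ha.2]
  have h2 : 0 ≤ (1 + a) / 2 := by linarith [ha.1]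
  unfold weight
  positivity

theorem sum_weight (N : ℕ) (a : ℝ) : ∑ ν ∈ Finset.range (N + 1), weight N a ν = 1 := by
  have := add_pow ((1 - a) / 2) ((1 + a) / 2) N
  rw [show (1 - a) / 2 + (1 + a) / 2 = 1 by ring, one_pow] at this
  rw [this]
  exact Finset.sum_congr rfl fun ν _ => by unfold weight; ring

/-- The constant is not sharp: 12 = 8 + 4 collects the moment errors for `k = 2` and `k = 1` with `R
= 1`. -/
theorem sum_weight_mul_sq_le {a : ℝ} (ha : a ∈ Icc (-1 : ℝ) 1) {N : ℕ} (hN : 0 < N) :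
    ∑ ν ∈ Finset.range (N + 1), weight N a ν * (node N ν - a) ^ 2 ≤ 12 / N := by
  have hN' : (0 : ℝ) < N := by positivity
  have ha' : |a| ≤ 1 := abs_le.2 ha
  have h1 := abs_sum_weight_mul_node_pow_sub_le le_rfl ha' hN 1
  have h2 := abs_sum_weight_mul_node_pow_sub_le le_rfl ha' hN 2
  simp only [one_pow, pow_one, Nat.cast_one, Nat.cast_ofNat] at h1 h2
  have e : ∑ ν ∈ Finset.range (N + 1), weight N a ν * (node N ν - a) ^ 2 =
      (∑ ν ∈ Finset.range (N + 1), weight N a ν * node N ν ^ 2 - a ^ 2) -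
      2 * a * (∑ ν ∈ Finset.range (N + 1), weight N a ν * node N ν - a) := by
    have : ∑ ν ∈ Finset.range (N + 1), weight N a ν * (node N ν - a) ^ 2 =
      ∑ ν ∈ Finset.range (N + 1), weight N a ν * node N ν ^ 2 -
      2 * a * ∑ ν ∈ Finset.range (N + 1), weight N a ν * node N ν +
      a ^ 2 * ∑ ν ∈ Finset.range (N + 1), weight N a ν := by
      rw [Finset.mul_sum, Finset.mul_sum, ← Finset.sum_sub_distrib, ← Finset.sum_add_distrib]
      exact Finset.sum_congr rfl fun ν _ => by ring
    rw [this, sum_weight]; ring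
  rw [e]
  set u := ∑ ν ∈ Finset.range (N + 1), weight N a ν * node N ν - a
  have h3 : |2 * a * u| ≤ 2 * 1 * (2 * 1 * (1 / N)) := by
    rw [abs_mul, abs_mul, abs_two]
    gcongr
  have h4 := (abs_le.1 h3).1
  have h5 := (abs_le.1 h2).2
  have h6 : (12 : ℝ) / N = 2 * 1 * (2 ^ 2 / N) + 2 * 1 * (2 * 1 * (1 / N)) := by ring
  linarith

/-! ### Geometric decay of the weights beyond the threshold -/

/-- Chernoff bound. A node below `T` has $\nu > N(1-T)/2$, so inserting $s^{\nu-N(1-T)/2}\ge 1$ for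
some $s>1$ and summing by the binomial theorem gives the `N`-th power of a rate. Its square at the
best `s` is `lemniscateFun T ρ + 1`, which is below 1 since `ρ < rho T`. -/
theorem exists_sum_abs_weight_le {T r : ℝ} (hT : T ∈ Ico (0 : ℝ) 1) (h1r : 1 < r)
    (hr : r < radius T) : ∃ θ ∈ Ico (0 : ℝ) 1, ∀ N : ℕ, 0 < N → ∀ a ∈ Icc 1 r,
      ∑ ν ∈ Finset.range (N + 1) with node N ν < T, |weight N a ν| ≤ θ ^ N := by
  have t1 : 0 < 1 - T := by linarith [hT.2]
  have t2 : 0 < 1 + T := by linarith [hT.1]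
  obtain ⟨ρ, rfl⟩ : ∃ ρ, r = 1 + ρ := ⟨r - 1, by ring⟩
  have hρ : 0 < ρ := by linarith
  have hρ' : ρ < rho T := by unfold radius at hr; linarith
  have hneg : lemniscateFun T ρ < 0 := by
    rw [← (rho_spec hT).2]
    exact lemniscateFun_strictMonoOn hT hρ.le (rho_spec hT).1.le hρ'
  set A := ρ / (1 - T) with hA
  set B := (ρ + 2) / (1 + T) with hB
  have hA0 : 0 < A := by positivity
  have hB1 : 1 < B := by rw [hB, one_lt_div t2]; linarith [hT.2]
  have hB0 : 0 < B := by linarith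
  have hAB : A ^ (1 - T) * B ^ (1 + T) < 1 := by unfold lemniscateFun at hneg; linarith
  have hA1 : A < 1 := by
    by_contra h
    have := Real.one_le_rpow (not_lt.1 h) t1.le
    have := Real.one_lt_rpow hB1 t2
    nlinarith
  -- The minimiser of $s^{-(1-T)/2}\,(s\rho/2+(\rho+2)/2)$; with this `s` the bracket equals `B`.
  set s := B / A with hs
  have hs1 : 1 < s := by rw [hs, one_lt_div hA0]; linarith
  have hs0 : 0 < s := by linarith
  set κ := s ^ ((1 - T) / 2) with hκ
  have hκ0 : 0 < κ := Real.rpow_pos_of_pos hs0 _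
  have hθ : B / κ < 1 := by
    have h2 : (B / κ) ^ 2 < 1 := by
      have e1 : κ ^ 2 = s ^ (1 - T) := by
        rw [hκ, ← Real.rpow_natCast, ← Real.rpow_mul hs0.le]; congr 1; push_cast; ring
      have e2 : B ^ 2 = B ^ (1 + T) * B ^ (1 - T) := by
        rw [← Real.rpow_add hB0, ← Real.rpow_natCast]; congr 1; push_cast; ring
      have e3 : 0 < A ^ (1 - T) := Real.rpow_pos_of_pos hA0 _
      have e4 : 0 < B ^ (1 - T) := Real.rpow_pos_of_pos hB0 _
      rw [div_pow, e1, e2, hs, Real.div_rpow hB0.le hA0.le]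
      convert hAB using 1
      field_simp
    by_contra h
    have := one_le_pow₀ (not_lt.1 h) (n := 2)
    linarith
  refine ⟨B / κ, ⟨by positivity, hθ⟩, fun N hN a ha => ?_⟩
  have hN' : (0 : ℝ) < N := by positivity
  have hsum : B ^ N = ∑ ν ∈ Finset.range (N + 1),
      (s * (ρ / 2)) ^ ν * ((2 + ρ) / 2) ^ (N - ν) * N.choose ν := by
    rw [← add_pow]
    congr 1
    rw [hs, hA]
    field_simp
    rw [hB]
    field_simp
    ring
  rw [div_pow, le_div_iff₀ (by positivity), hsum, Finset.sum_mul]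
  refine le_trans ?_ (Finset.sum_le_sum_of_subset_of_nonneg
    (Finset.filter_subset (fun ν => node N ν < T) _) fun ν _ _ => by positivity)
  refine Finset.sum_le_sum fun ν hν => ?_
  have hν' := (Finset.mem_filter.1 hν).2
  have hlow : κ ^ N ≤ s ^ ν := by
    rw [hκ, ← Real.rpow_natCast, ← Real.rpow_mul hs0.le, ← Real.rpow_natCast]
    refine Real.rpow_le_rpow_of_exponent_le hs1.le ?_
    unfold node at hν'
    have : (1 - T) / 2 < (ν : ℝ) / N := by linarith
    rw [lt_div_iff₀ hN'] at this
    exact this.le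
  have hw : |weight N a ν| ≤ N.choose ν * (ρ / 2) ^ ν * ((2 + ρ) / 2) ^ (N - ν) := by
    have h1 : |(1 - a) / 2| ≤ ρ / 2 := abs_le.2 ⟨by linarith [ha.2], by linarith [ha.1]⟩
    have h2 : |(1 + a) / 2| ≤ (2 + ρ) / 2 := abs_le.2 ⟨by linarith [ha.1], by linarith [ha.2]⟩
    rw [weight, abs_mul, abs_mul, abs_pow, abs_pow, Nat.abs_cast]
    gcongr
  calc |weight N a ν| * κ ^ N
      ≤ (N.choose ν * (ρ / 2) ^ ν * ((2 + ρ) / 2) ^ (N - ν)) * s ^ ν := by gcongr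
    _ = _ := by rw [mul_pow]; ring

theorem weight_neg {N ν : ℕ} (a : ℝ) (hν : ν ≤ N) : weight N (-a) ν = weight N a (N - ν) := by
  unfold weight
  rw [Nat.choose_symm hν, Nat.sub_sub_self hν]
  ring

theorem node_sub {N ν : ℕ} (hN : 0 < N) (hν : ν ≤ N) : node N (N - ν) = -node N ν := by
  have hN' : (N : ℝ) ≠ 0 := by positivity
  unfold node
  rw [Nat.cast_sub hν]
  field_simp
  ring

theorem sum_abs_weight_neg {N : ℕ} (hN : 0 < N) (a T : ℝ) :
    ∑ ν ∈ Finset.range (N + 1) with -T < node N ν, |weight N a ν| =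
      ∑ ν ∈ Finset.range (N + 1) with node N ν < T, |weight N (-a) ν| := by
  refine Finset.sum_nbij' (fun ν => N - ν) (fun ν => N - ν) ?_ ?_ ?_ ?_ ?_ <;>
    simp only [Finset.mem_filter, Finset.mem_range, Nat.lt_succ_iff] <;> rintro ν ⟨hν, h⟩
  · exact ⟨Nat.sub_le _ _, by rw [node_sub hN hν]; linarith⟩
  · exact ⟨Nat.sub_le _ _, by rw [node_sub hN hν]; linarith⟩
  · omega
  · omega
  · rw [weight_neg a (Nat.sub_le _ _), Nat.sub_sub_self hν]

/-! ### One-variable convergence, holomorphic and continuous -/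

theorem exists_hasSum_of_differentiableOn {h : ℂ → ℂ} {r R M : ℝ} (hR : 0 < R) (hRr : R < r)
    (hd : DifferentiableOn ℂ h (Metric.ball 0 r)) (hM : ∀ z ∈ Metric.closedBall 0 R, ‖h z‖ ≤ M) :
    ∃ c : ℕ → ℂ, (∀ k, ‖c k‖ ≤ M / R ^ k) ∧
      ∀ z : ℂ, ‖z‖ < R → HasSum (fun k => c k * z ^ k) (h z) := by
  have hsub : Metric.closedBall (0 : ℂ) R ⊆ Metric.ball 0 r := Metric.closedBall_subset_ball hRr
  have hd' : DifferentiableOn ℂ h (Metric.ball 0 R) :=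
    hd.mono (Metric.ball_subset_closedBall.trans hsub)
  have hdc : DiffContOnCl ℂ h (Metric.ball 0 R) :=
    DifferentiableOn.diffContOnCl (hd.mono (Metric.closure_ball_subset_closedBall.trans hsub))
  refine ⟨fun k => (k.factorial : ℂ)⁻¹ * iteratedDeriv k h 0, fun k => ?_, fun z hz => ?_⟩
  · have := Complex.norm_iteratedDeriv_le_of_forall_mem_sphere_norm_le k hR hdc
      fun z hz => hM z (Metric.sphere_subset_closedBall hz)
    rw [norm_mul, norm_inv, Complex.norm_natCast, inv_mul_le_iff₀ (by positivity)]
    rwa [mul_div_assoc] at this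
  · have := Complex.hasSum_taylorSeries_on_ball hd' (z := z) (by simpa using hz)
    rw [show (fun k : ℕ => (k.factorial : ℂ)⁻¹ * iteratedDeriv k h 0 * z ^ k) =
      fun k : ℕ => (k.factorial : ℂ)⁻¹ • (z - 0) ^ k • iteratedDeriv k h 0 by
        ext k; simp only [smul_eq_mul, sub_zero]; ring]
    exact this

/-- The Bernstein functional on a function of one complex variable. -/
def bernsteinApply (N : ℕ) (a : ℝ) (h : ℂ → ℂ) : ℂ :=
  ∑ ν ∈ Finset.range (N + 1), (weight N a ν : ℂ) * h (node N ν)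

theorem bernsteinApply_pow (N : ℕ) (a : ℝ) (k : ℕ) : bernsteinApply N a (fun z => z ^ k) =
    ((∑ ν ∈ Finset.range (N + 1), weight N a ν * node N ν ^ k : ℝ) : ℂ) := by
  simp [bernsteinApply]

theorem abs_node_le {N ν : ℕ} (hν : ν ∈ Finset.range (N + 1)) : |node N ν| ≤ 1 :=
  abs_le.2 (node_mem_Icc hν)

theorem hasSum_bernsteinApply {h : ℂ → ℂ} {c : ℕ → ℂ} {R : ℝ} (hR : 1 < R)
    (hc : ∀ z : ℂ, ‖z‖ < R → HasSum (fun k => c k * z ^ k) (h z)) (N : ℕ) (a : ℝ) :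
    HasSum (fun k => c k * bernsteinApply N a (fun z => z ^ k)) (bernsteinApply N a h) := by
  have : HasSum (fun k => ∑ ν ∈ Finset.range (N + 1),
      (weight N a ν : ℂ) * (c k * (node N ν : ℂ) ^ k)) (bernsteinApply N a h) := by
    refine hasSum_sum fun ν hν => (hc _ ?_).mul_left _
    rw [Complex.norm_real, Real.norm_eq_abs]
    exact (abs_node_le hν).trans_lt hR
  rw [show (fun k => c k * bernsteinApply N a (fun z => z ^ k)) = fun k =>
    ∑ ν ∈ Finset.range (N + 1), (weight N a ν : ℂ) * (c k * (node N ν : ℂ) ^ k) by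
      ext k
      rw [bernsteinApply, Finset.mul_sum]
      exact Finset.sum_congr rfl fun ν _ => by ring]
  exact this

/-- Cauchy estimates on the larger radius `R'` turn the error on the `k`-th monomial into
$2k^2(R/R')^k M/N$, which is summable. The constant depends only on the radii, so the bound is
uniform in `h`. -/
theorem exists_norm_bernsteinApply_sub_le {r R R' : ℝ} (hR : 1 ≤ R) (hRR' : R < R') (hR' : R' < r) :
    ∃ C : ℝ, ∀ N : ℕ, 0 < N → ∀ a : ℝ, |a| ≤ R → ∀ (h : ℂ → ℂ) (M : ℝ),
      DifferentiableOn ℂ h (Metric.ball 0 r) → (∀ z ∈ Metric.closedBall 0 R', ‖h z‖ ≤ M) →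
      ‖bernsteinApply N a h - h a‖ ≤ C / N * M := by
  have hR0 : 0 < R' := by linarith
  obtain ⟨q, hq⟩ : ∃ q, q = R / R' := ⟨_, rfl⟩
  have hq0 : 0 ≤ q := by rw [hq]; positivity
  have hq1 : q < 1 := by rw [hq, div_lt_one hR0]; exact hRR'
  have hq2 : ‖q‖ < 1 := by rwa [Real.norm_eq_abs, abs_of_nonneg hq0]
  have s2 : Summable (fun k : ℕ => 2 * ((k : ℝ) ^ 2 * q ^ k)) :=
    Summable.mul_left 2 (summable_pow_mul_geometric_of_norm_lt_one 2 hq2)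
  refine ⟨∑' k : ℕ, 2 * ((k : ℝ) ^ 2 * q ^ k), fun N hN a ha h M hd hM => ?_⟩
  have hN' : (0 : ℝ) < N := by positivity
  have hM0 : 0 ≤ M := (norm_nonneg _).trans (hM 0 (by simp [hR0.le]))
  obtain ⟨c, hc, hcs⟩ := exists_hasSum_of_differentiableOn hR0 hR' hd hM
  have hL := hasSum_bernsteinApply (by linarith) hcs N a
  have ha' : ‖(a : ℂ)‖ < R' := by
    rw [Complex.norm_real, Real.norm_eq_abs]; exact ha.trans_lt hRR'
  rw [div_mul_eq_mul_div, mul_div_assoc]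
  refine (hL.sub (hcs a ha')).norm_le_of_bounded (s2.hasSum.mul_right (M / N)) fun k => ?_
  rw [← mul_sub, norm_mul, bernsteinApply_pow, ← Complex.ofReal_pow, ← Complex.ofReal_sub,
    Complex.norm_real, Real.norm_eq_abs]
  calc _ ≤ M / R' ^ k * (2 * R ^ k * (k ^ 2 / N)) := by
        gcongr
        · exact hc k
        · exact abs_sum_weight_mul_node_pow_sub_le hR ha hN k
    _ = _ := by rw [hq, div_pow]; ring

theorem norm_bernsteinApply_le {N : ℕ} {a : ℝ} (ha : a ∈ Icc (-1 : ℝ) 1) {h : ℂ → ℂ} {M : ℝ}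
    (hM : ∀ t ∈ Icc (-1 : ℝ) 1, ‖h t‖ ≤ M) : ‖bernsteinApply N a h‖ ≤ M := by
  have : M = ∑ ν ∈ Finset.range (N + 1), weight N a ν * M := by
    rw [← Finset.sum_mul, sum_weight, one_mul]
  rw [this]
  refine norm_sum_le_of_le _ fun ν hν => ?_
  rw [norm_mul, Complex.norm_real, Real.norm_eq_abs, abs_of_nonneg (weight_nonneg ha N ν)]
  exact mul_le_mul_of_nonneg_left (hM _ (node_mem_Icc hν)) (weight_nonneg ha N ν)

/-- Bernstein's classical proof: the modulus of continuity controls nodes near `a`, and Chebyshev's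
inequality the others. -/
theorem norm_bernsteinApply_sub_le {N : ℕ} (hN : 0 < N) {a : ℝ} (ha : a ∈ Icc (-1 : ℝ) 1)
    {h : ℂ → ℂ} {M δ η : ℝ} (hδ : 0 < δ) (hη : 0 ≤ η) (hM : ∀ t ∈ Icc (-1 : ℝ) 1, ‖h t‖ ≤ M)
    (hh : ∀ t ∈ Icc (-1 : ℝ) 1, |t - a| < δ → ‖h t - h a‖ ≤ η) :
    ‖bernsteinApply N a h - h a‖ ≤ η + 2 * M / δ ^ 2 * (12 / N) := by
  have hM0 : 0 ≤ M := (norm_nonneg _).trans (hM a ha)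
  have e : bernsteinApply N a h - h a =
      ∑ ν ∈ Finset.range (N + 1), (weight N a ν : ℂ) * (h (node N ν) - h a) := by
    simp only [mul_sub, Finset.sum_sub_distrib, ← Finset.sum_mul, ← Complex.ofReal_sum, sum_weight]
    simp [bernsteinApply]
  have e2 : η = ∑ ν ∈ Finset.range (N + 1), weight N a ν * η := by
    rw [← Finset.sum_mul, sum_weight, one_mul]
  rw [e]
  calc _ ≤ ∑ ν ∈ Finset.range (N + 1), weight N a ν * (η + 2 * M / δ ^ 2 * (node N ν - a) ^ 2) := by
        refine norm_sum_le_of_le _ fun ν hν => ?_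
        rw [norm_mul, Complex.norm_real, Real.norm_eq_abs, abs_of_nonneg (weight_nonneg ha N ν)]
        refine mul_le_mul_of_nonneg_left ?_ (weight_nonneg ha N ν)
        rcases lt_or_ge |node N ν - a| δ with hlt | hge
        · have : 0 ≤ 2 * M / δ ^ 2 * (node N ν - a) ^ 2 := by positivity
          linarith [hh _ (node_mem_Icc hν) hlt]
        · have h1 : δ ^ 2 ≤ (node N ν - a) ^ 2 := by
            rw [← sq_abs (node N ν - a)]; gcongr
          have h2 : 2 * M ≤ 2 * M / δ ^ 2 * (node N ν - a) ^ 2 := by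
            rw [div_mul_eq_mul_div, le_div_iff₀ (by positivity)]; gcongr
          have := norm_sub_le (h (node N ν)) (h a)
          linarith [hM _ (node_mem_Icc hν), hM a ha]
    _ = η + 2 * M / δ ^ 2 * ∑ ν ∈ Finset.range (N + 1), weight N a ν * (node N ν - a) ^ 2 := by
        nth_rewrite 2 [e2]
        rw [Finset.mul_sum, ← Finset.sum_add_distrib]
        exact Finset.sum_congr rfl fun ν _ => by ring
    _ ≤ _ := by gcongr; exact sum_weight_mul_sq_le ha hN

/-! ### Tensor products of finitely supported functionals -/

/-- The tensor product of the finitely supported functionals `h ↦ ∑ i ∈ s j, c j i * h (z j i)`. -/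
def tensorApply {m : ℕ} (s : Fin m → Finset ℕ) (c z : Fin m → ℕ → ℂ) (F : (Fin m → ℂ) → ℂ) : ℂ :=
  ∑ ν ∈ Fintype.piFinset s, (∏ j, c j (ν j)) * F fun j => z j (ν j)

theorem tensorApply_zero (s : Fin 0 → Finset ℕ) (c z : Fin 0 → ℕ → ℂ) (F : (Fin 0 → ℂ) → ℂ)
    (w : Fin 0 → ℂ) : tensorApply s c z F = F w := by
  rw [tensorApply, Fintype.piFinset_of_isEmpty, Fintype.sum_unique]
  simp [Subsingleton.elim w default, Subsingleton.elim (fun j : Fin 0 => z j _) default]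

theorem tensorApply_succ {m : ℕ} (s : Fin (m + 1) → Finset ℕ) (c z : Fin (m + 1) → ℕ → ℂ)
    (F : (Fin (m + 1) → ℂ) → ℂ) :
    tensorApply s c z F = tensorApply (fun j => s j.succ) (fun j => c j.succ) (fun j => z j.succ)
      (fun w => ∑ i ∈ s 0, c 0 i * F (Fin.cons (z 0 i) w)) := by
  have h := Finset.filter_piFinset_eq_map_consEquiv s (fun _ => True)
  simp only [Finset.filter_true] at h
  have hz : ∀ (i : ℕ) (ν : Fin m → ℕ), (fun j => z j ((Fin.cons i ν : Fin (m + 1) → ℕ) j)) =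
      Fin.cons (z 0 i) fun j => z j.succ (ν j) := by
    intro i ν
    ext j
    cases j using Fin.cases <;> simp
  rw [tensorApply, h, Finset.sum_map, Finset.sum_product, Finset.sum_comm, tensorApply]
  refine Finset.sum_congr rfl fun ν _ => ?_
  rw [Finset.mul_sum]
  refine Finset.sum_congr rfl fun i _ => ?_
  simp [Fin.consEquiv, hz, Fin.prod_univ_succ]
  ring

theorem tensorApply_sub {m : ℕ} (s : Fin m → Finset ℕ) (c z : Fin m → ℕ → ℂ)
    (F G : (Fin m → ℂ) → ℂ) :
    tensorApply s c z (fun w => F w - G w) = tensorApply s c z F - tensorApply s c z G := by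
  simp [tensorApply, mul_sub]

/-- Functions that belong to `H j` as functions of the `j`th variable, when the other variables are
fixed in the sets `D i`. -/
def SeparatelyIn {m : ℕ} (H : Fin m → Submodule ℂ (ℂ → ℂ)) (D : Fin m → Set ℂ)
    (F : (Fin m → ℂ) → ℂ) : Prop :=
  ∀ w, (∀ j, w j ∈ D j) → ∀ j, (fun z => F (Function.update w j z)) ∈ H j

section Cons

variable {m : ℕ} {H : Fin (m + 1) → Submodule ℂ (ℂ → ℂ)} {D : Fin (m + 1) → Set ℂ}
  {F : (Fin (m + 1) → ℂ) → ℂ}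

theorem cons_mem {x : ℂ} {w : Fin m → ℂ} (hx : x ∈ D 0) (hw : ∀ j, w j ∈ D (Fin.succ j))
    (j : Fin (m + 1)) : (Fin.cons x w : Fin (m + 1) → ℂ) j ∈ D j := by
  cases j using Fin.cases with
  | zero => simpa using hx
  | succ j => simpa using hw j

theorem SeparatelyIn.head (hF : SeparatelyIn H D F) (hD : (D 0).Nonempty) {w : Fin m → ℂ}
    (hw : ∀ j, w j ∈ D (Fin.succ j)) : (fun z => F (Fin.cons z w)) ∈ H 0 := by
  obtain ⟨d, hd⟩ := hD
  simpa [Fin.update_cons_zero] using hF _ (cons_mem hd hw) 0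

theorem SeparatelyIn.tail (hF : SeparatelyIn H D F) {x : ℂ} (hx : x ∈ D 0) :
    SeparatelyIn (fun j => H (Fin.succ j)) (fun j => D (Fin.succ j))
      (fun w => F (Fin.cons x w)) := by
  intro w hw j
  have := hF _ (cons_mem hx hw) j.succ
  simpa [Fin.cons_update] using this

end Cons

theorem SeparatelyIn.sum_mul {m : ℕ} {H : Fin m → Submodule ℂ (ℂ → ℂ)} {D : Fin m → Set ℂ}
    {s : Finset ℕ} {c : ℕ → ℂ} {G : ℕ → (Fin m → ℂ) → ℂ}
    (hG : ∀ i ∈ s, SeparatelyIn H D (G i)) :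
    SeparatelyIn H D fun w => ∑ i ∈ s, c i * G i w := by
  intro w hw j
  have : (fun z => ∑ i ∈ s, c i * G i (Function.update w j z)) =
      ∑ i ∈ s, c i • fun z => G i (Function.update w j z) := by
    ext z; simp
  rw [this]
  exact Submodule.sum_mem _ fun i hi => Submodule.smul_mem _ _ (hG i hi w hw j)

theorem SeparatelyIn.sub {m : ℕ} {H : Fin m → Submodule ℂ (ℂ → ℂ)} {D : Fin m → Set ℂ}
    {F G : (Fin m → ℂ) → ℂ} (hF : SeparatelyIn H D F) (hG : SeparatelyIn H D G) :
    SeparatelyIn H D fun w => F w - G w :=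
  fun w hw j => (H j).sub_mem (hF w hw j) (hG w hw j)

/-- The functional `h ↦ ∑ i ∈ s, c i * h (z i)` has norm at most `C` on `H` for the supremum norm
on `D`. -/
def NormLEOn (H : Submodule ℂ (ℂ → ℂ)) (D : Set ℂ) (C : ℝ) (s : Finset ℕ) (c z : ℕ → ℂ) : Prop :=
  ∀ h ∈ H, ∀ M : ℝ, (∀ x ∈ D, ‖h x‖ ≤ M) → ‖∑ i ∈ s, c i * h (z i)‖ ≤ C * M

/-- Apply the functionals one variable at a time. Each application preserves separate membership in
the other variables, so joint regularity is never needed. -/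
theorem norm_tensorApply_le {m : ℕ} {H : Fin m → Submodule ℂ (ℂ → ℂ)} {D : Fin m → Set ℂ}
    {s : Fin m → Finset ℕ} {c z : Fin m → ℕ → ℂ} {C : Fin m → ℝ} (hD : ∀ j, (D j).Nonempty)
    (hz : ∀ j, ∀ i ∈ s j, z j i ∈ D j) (hL : ∀ j, NormLEOn (H j) (D j) (C j) (s j) (c j) (z j))
    {F : (Fin m → ℂ) → ℂ} (hF : SeparatelyIn H D F) {M : ℝ}
    (hM : ∀ w, (∀ j, w j ∈ D j) → ‖F w‖ ≤ M) : ‖tensorApply s c z F‖ ≤ (∏ j, C j) * M := by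
  induction m generalizing M with
  | zero => simpa [tensorApply_zero s c z F Fin.elim0] using hM Fin.elim0 fun j => j.elim0
  | succ m ih =>
    rw [tensorApply_succ, Fin.prod_univ_succ, mul_comm (C 0), mul_assoc]
    refine ih (fun j => hD j.succ) (fun j => hz j.succ) (fun j => hL j.succ)
      (SeparatelyIn.sum_mul fun i hi => hF.tail (hz 0 i hi)) fun w hw => ?_
    exact hL 0 _ (hF.head (hD 0) hw) M fun x hx => hM _ (cons_mem hx hw)

/-- Telescoping: $L_0\otimes L'-\delta_{a_0}\otimes\delta_{a'}=(L_0-\delta_{a_0})\otimes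
L'+\delta_{a_0}\otimes(L'-\delta_{a'})$. The condition `1 ≤ C j` allows every term to be bounded by
the full product. -/
theorem norm_tensorApply_sub_le {m : ℕ} {H : Fin m → Submodule ℂ (ℂ → ℂ)} {D : Fin m → Set ℂ}
    {s : Fin m → Finset ℕ} {c z : Fin m → ℕ → ℂ} {C : Fin m → ℝ} (hC : ∀ j, 1 ≤ C j)
    (hz : ∀ j, ∀ i ∈ s j, z j i ∈ D j) (hL : ∀ j, NormLEOn (H j) (D j) (C j) (s j) (c j) (z j))
    {a : Fin m → ℂ} (ha : ∀ j, a j ∈ D j)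
    {F : (Fin m → ℂ) → ℂ} (hF : SeparatelyIn H D F) {η : ℝ} (hη : 0 ≤ η)
    (hM : ∀ w, (∀ j, w j ∈ D j) → ∀ j, ‖∑ i ∈ s j, c j i * F (Function.update w j (z j i)) -
      F (Function.update w j (a j))‖ ≤ η) :
    ‖tensorApply s c z F - F a‖ ≤ m * (∏ j, C j) * η := by
  induction m with
  | zero => simp [tensorApply_zero s c z F a]
  | succ m ih =>
    have hP : 0 ≤ ∏ j : Fin m, C j.succ :=
      Finset.prod_nonneg fun j _ => zero_le_one.trans (hC j.succ)
    set G : (Fin m → ℂ) → ℂ := fun w => F (Fin.cons (a 0) w) with hG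
    have hsep : SeparatelyIn (fun j : Fin m => H j.succ) (fun j => D j.succ) G := hF.tail (ha 0)
    have ea : F a = G fun j => a j.succ := by
      rw [hG]
      exact congrArg F (Fin.cons_self_tail a).symm
    have h1 := ih (fun j => hC j.succ) (fun j => hz j.succ) (fun j => hL j.succ)
      (fun j => ha j.succ) hsep fun w hw j => by
        have := hM _ (cons_mem (ha 0) hw) j.succ
        simpa [hG, Fin.cons_update] using this
    have h2 : ‖tensorApply (fun j => s j.succ) (fun j => c j.succ) (fun j => z j.succ)
        (fun w => ∑ i ∈ s 0, c 0 i * F (Fin.cons (z 0 i) w) - G w)‖ ≤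
        (∏ j : Fin m, C j.succ) * η := by
      refine norm_tensorApply_le (fun j => ⟨_, ha j.succ⟩) (fun j => hz j.succ)
        (fun j => hL j.succ)
        ((SeparatelyIn.sum_mul fun i hi => hF.tail (hz 0 i hi)).sub hsep) fun w hw => ?_
      simpa [Fin.update_cons_zero] using hM _ (cons_mem (ha 0) hw) 0
    rw [tensorApply_sub] at h2
    rw [tensorApply_succ, ea]
    have tri := norm_add_le _ _ |>.trans (add_le_add h2 h1)
    rw [sub_add_sub_cancel] at tri
    refine tri.trans ?_
    rw [Fin.prod_univ_succ]
    push_cast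
    calc _ = 1 * ((m + 1) * (∏ j : Fin m, C j.succ) * η) := by ring
      _ ≤ C 0 * ((m + 1) * (∏ j : Fin m, C j.succ) * η) :=
        mul_le_mul_of_nonneg_right (hC 0) (by positivity)
      _ = _ := by ring

/-! ### Extensions of φ, jointly continuous and separately holomorphic -/

/-- The segment `[-1, 1]` in the complex plane. -/
def unitSegment : Set ℂ := (fun t : ℝ => (t : ℂ)) '' Icc (-1) 1

/-- The product of the discs of radius `r j`, for `j ∈ J`, and of segments `[-1, 1]`. -/
def mixedDomain {m : ℕ} (r : Fin m → ℝ) (J : Finset (Fin m)) : Set (Fin m → ℂ) :=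
  {w | (∀ j ∈ J, ‖w j‖ < r j) ∧ ∀ j ∉ J, w j ∈ unitSegment}

theorem ofReal_mem_unitSegment {t : ℝ} : (t : ℂ) ∈ unitSegment ↔ t ∈ Icc (-1 : ℝ) 1 := by
  simp [unitSegment]

/-- A family of functions on `mixedDomain r J` that is jointly continuous, holomorphic in every
variable `w j` with `j ∈ J`, and restricts to `φ` on the real points of the cell given by
`Jm`, `Jp` and `T`. -/
structure IsExtension {m : ℕ} {R : Type*} [TopologicalSpace R] (r T : Fin m → ℝ)
    (φ : (Fin m → ℝ) × R → ℂ) (Jm Jp : Finset (Fin m)) (F : R → (Fin m → ℂ) → ℂ) : Prop where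
  continuousOn : ContinuousOn (fun p : R × (Fin m → ℂ) => F p.1 p.2)
    (univ ×ˢ mixedDomain r (Jm ∪ Jp))
  differentiableOn : ∀ x, ∀ w ∈ mixedDomain r (Jm ∪ Jp), ∀ j ∈ Jm ∪ Jp,
    DifferentiableOn ℂ (fun z => F x (Function.update w j z)) (Metric.ball 0 (r j))
  eq_of_mem : ∀ x, ∀ a ∈ box r, (∀ j ∈ Jm, a j ≤ -T j) → (∀ j ∈ Jp, T j ≤ a j) →
    (∀ j ∉ Jm ∪ Jp, a j ∈ Icc (-1 : ℝ) 1) → F x (fun j => a j) = φ (a, x)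

/-- The case not covered by the hypothesis on holomorphic extensions: no holomorphy is required, and
continuity of φ suffices. -/
theorem isExtension_empty {m : ℕ} {R : Type*} [TopologicalSpace R] {r T : Fin m → ℝ}
    {φ : (Fin m → ℝ) × R → ℂ} (hr : ∀ j, 1 < r j) (hφ : ContinuousOn φ (box r ×ˢ univ)) :
    IsExtension r T φ ∅ ∅ fun x w => φ (fun j => (w j).re, x) where
  continuousOn := by
    refine hφ.comp (f := fun p : R × (Fin m → ℂ) => ((fun j => (p.2 j).re : Fin m → ℝ), p.1))
      (Continuous.continuousOn (by fun_prop)) ?_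
    rintro ⟨x, w⟩ ⟨-, -, hw⟩
    refine ⟨fun j => ?_, mem_univ _⟩
    obtain ⟨t, ht, htw⟩ := hw j (by simp)
    simp only at htw
    simp only [← htw, Complex.ofReal_re]
    exact ⟨by linarith [ht.1, hr j], by linarith [ht.2, hr j]⟩
  differentiableOn := by simp
  eq_of_mem := by simp

/-- Joint continuity holds because evaluation is jointly continuous for the compact-open topology
over a locally compact space. -/
theorem exists_isExtension {m : ℕ} {R : Type*} [TopologicalSpace R] {r T : Fin m → ℝ}
    {φ : (Fin m → ℝ) × R → ℂ} {Jm Jp : Finset (Fin m)}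
    (hf : ∃ f : {α : ↥(Jm ∪ Jp)ᶜ → ℝ // ∀ j, α j ∈ Icc (-1 : ℝ) 1} × R →
          Hol (polydisc (fun j : ↥(Jm ∪ Jp) => r j)),
        Continuous f ∧
        ∀ (x : R) (a : Fin m → ℝ) (ha : a ∈ box r),
          (∀ j ∈ Jm, a j ≤ -T j) → (∀ j ∈ Jp, T j ≤ a j) →
          ∀ hJ' : ∀ j : ↥(Jm ∪ Jp)ᶜ, a j ∈ Icc (-1 : ℝ) 1,
            φ (a, x) = (f (⟨fun j => a j, hJ'⟩, x)).1 (restrictBox (Jm ∪ Jp) a ha)) :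
    ∃ F, IsExtension r T φ Jm Jp F := by
  classical
  obtain ⟨f, hfc, hfφ⟩ := hf
  have hmem : ∀ α : ↥(Jm ∪ Jp)ᶜ → ℝ, ∀ j,
      (projIcc (-1 : ℝ) 1 (by norm_num) (α j) : ℝ) ∈ Icc (-1 : ℝ) 1 :=
    fun α j => Subtype.mem _
  -- Clamping to [-1, 1] makes the parameter a total continuous function of `w`; it changes nothing
  -- on `mixedDomain`.
  let α : (Fin m → ℂ) → {α : ↥(Jm ∪ Jp)ᶜ → ℝ // ∀ j, α j ∈ Icc (-1 : ℝ) 1} := fun w =>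
    ⟨fun j => projIcc (-1 : ℝ) 1 (by norm_num) (w j).re, hmem fun j => (w j).re⟩
  have hα : Continuous α := by
    refine Continuous.subtype_mk (continuous_pi fun j => ?_) _
    exact continuous_subtype_val.comp (continuous_projIcc.comp (by fun_prop))
  let U := polydisc (fun j : ↥(Jm ∪ Jp) => r j)
  have hU : IsOpen U := by
    have : U = ⋂ j : ↥(Jm ∪ Jp), {w : ↥(Jm ∪ Jp) → ℂ | ‖w j‖ < r j} := by ext w; simp [U, polydisc]
    rw [this]
    exact isOpen_iInter_of_finite fun j => isOpen_lt (by fun_prop) continuous_const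
  have : LocallyCompactSpace U := hU.locallyCompactSpace
  let F : R → (Fin m → ℂ) → ℂ := fun x w =>
    if h : (fun j : ↥(Jm ∪ Jp) => w j) ∈ U then (f (α w, x)).1 ⟨_, h⟩ else 0
  have hF : ∀ x w (h : (fun j : ↥(Jm ∪ Jp) => w j) ∈ U), F x w = (f (α w, x)).1 ⟨_, h⟩ :=
    fun x w h => dif_pos h
  refine ⟨F, ?_, ?_, ?_⟩
  · rw [continuousOn_iff_continuous_domRestrict]
    have hin : ∀ p : ↥((univ : Set R) ×ˢ mixedDomain r (Jm ∪ Jp)),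
        (fun j : ↥(Jm ∪ Jp) => p.1.2 j) ∈ U :=
      fun p j => p.2.2.1 j j.2
    have : (((univ : Set R) ×ˢ mixedDomain r (Jm ∪ Jp)).domRestrict
        fun p : R × (Fin m → ℂ) => F p.1 p.2) =
        fun p => (f (α p.1.2, p.1.1)).1 ⟨_, hin p⟩ := by
      ext p
      exact hF _ _ (hin p)
    rw [this]
    have h1 : Continuous fun p : ↥((univ : Set R) ×ˢ mixedDomain r (Jm ∪ Jp)) =>
        (f (α p.1.2, p.1.1)).1 :=
      continuous_subtype_val.comp (hfc.comp
        ((hα.comp (by fun_prop)).prodMk (by fun_prop)))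
    have h2 : Continuous fun p : ↥((univ : Set R) ×ˢ mixedDomain r (Jm ∪ Jp)) =>
        (⟨_, hin p⟩ : U) := Continuous.subtype_mk (by fun_prop) _
    exact h1.eval h2
  · intro x w hw j hj
    obtain ⟨g, hg, hfg⟩ := (f (α w, x)).2
    have hαw : ∀ z, α (Function.update w j z) = α w := by
      intro z
      refine Subtype.ext (funext fun i => ?_)
      have : (i : Fin m) ≠ j := fun h => Finset.mem_compl.1 i.2 (h ▸ hj)
      simp [α, Function.update_of_ne this]
    have hUz : ∀ z ∈ Metric.ball (0 : ℂ) (r j),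
        (fun i : ↥(Jm ∪ Jp) => Function.update w j z i) ∈ U := by
      intro z hz i
      rcases eq_or_ne (i : Fin m) j with h | h
      · simpa [h] using hz
      · simpa [Function.update_of_ne h] using hw.1 i i.2
    have hd : DifferentiableOn ℂ (fun z => g fun i : ↥(Jm ∪ Jp) => Function.update w j z i)
        (Metric.ball 0 (r j)) := by
      refine hg.comp (f := fun z => fun i : ↥(Jm ∪ Jp) => Function.update w j z i) ?_ hUz
      refine Differentiable.differentiableOn (differentiable_pi.2 fun i => ?_)
      rcases eq_or_ne (i : Fin m) j with h | h
      · simp [h]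
      · simp [Function.update_of_ne h]
    refine hd.congr fun z hz => ?_
    rw [hF x _ (hUz z hz), hαw]
    exact hfg _
  · intro x a ha hm hp hc
    have hU' : (fun j : ↥(Jm ∪ Jp) => ((a j : ℝ) : ℂ)) ∈ U := (restrictBox (Jm ∪ Jp) a ha).2
    have hJ' : ∀ j : ↥(Jm ∪ Jp)ᶜ, a j ∈ Icc (-1 : ℝ) 1 := fun j => hc j (Finset.mem_compl.1 j.2)
    have hαa : α (fun j => a j) = ⟨fun j => a j, hJ'⟩ := by
      refine Subtype.ext (funext fun i => ?_)
      simp only [α, Complex.ofReal_re]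
      rw [projIcc_of_mem _ (hJ' i)]
    rw [hF x (fun j => a j) hU', hfφ x a ha hm hp hJ', hαa]
    rfl

/-! ### Good and bad nodes in one coordinate -/

theorem eventually_minAtTop {m : ℕ} {P : Fin m → ℕ → Prop}
    (h : ∀ j, ∀ᶠ n : ℕ in atTop, P j n) : ∀ᶠ N in minAtTop m, ∀ j, P j (N j) := by
  choose n hn using fun j => eventually_atTop.1 (h j)
  have : ∀ᶠ k : ℕ in atTop, Finset.univ.sup n ≤ k := eventually_ge_atTop _
  filter_upwards [this.comap (fun N : Fin m → ℕ+ => ⨅ j, (N j : ℕ))] with N hN j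
  exact hn j _ ((Finset.le_sup (Finset.mem_univ j)).trans
    (hN.trans (ciInf_le (OrderBot.bddBelow _) j)))

open scoped Classical in
/-- The indices of the nodes that lie outside the half-line where the extension applies: nodes
below `T` if `jp` holds, nodes above `-T` if `jm` holds. -/
def badIndices (jm jp : Prop) (T : ℝ) (N : ℕ) : Finset ℕ :=
  {ν ∈ Finset.range (N + 1) | (jp ∧ node N ν < T) ∨ (jm ∧ -T < node N ν)}

/-- The indices that are not in `badIndices`. -/
def goodIndices (jm jp : Prop) (T : ℝ) (N : ℕ) : Finset ℕ :=
  Finset.range (N + 1) \ badIndices jm jp T N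

/-- The real points with `|a| ≤ ρ` that are at least `1` if `jp` holds, at most `-1` if `jm` holds,
and in `[-1, 1]` otherwise. -/
def region (jm jp : Prop) (ρ : ℝ) : Set ℝ :=
  {a | |a| ≤ ρ ∧ (jp → 1 ≤ a) ∧ (jm → a ≤ -1) ∧ (¬(jm ∨ jp) → a ∈ Icc (-1 : ℝ) 1)}

theorem badIndices_subset (jm jp : Prop) (T : ℝ) (N : ℕ) :
    badIndices jm jp T N ⊆ Finset.range (N + 1) := by
  classical exact Finset.filter_subset _ _

theorem goodIndices_subset (jm jp : Prop) (T : ℝ) (N : ℕ) :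
    goodIndices jm jp T N ⊆ Finset.range (N + 1) := Finset.sdiff_subset

theorem badIndices_eq_empty {jm jp : Prop} (h : ¬(jm ∨ jp)) (T : ℝ) (N : ℕ) :
    badIndices jm jp T N = ∅ := by
  classical
  unfold badIndices
  exact Finset.filter_false_of_mem fun ν _ => by tauto

theorem goodIndices_eq_range {jm jp : Prop} (h : ¬(jm ∨ jp)) (T : ℝ) (N : ℕ) :
    goodIndices jm jp T N = Finset.range (N + 1) := by
  rw [goodIndices, badIndices_eq_empty h, Finset.sdiff_empty]

theorem eventually_sum_badIndices_le {jm jp : Prop} (hj : ¬(jm ∧ jp)) {T ρ : ℝ}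
    (hT : T ∈ Ico (0 : ℝ) 1) (hρ1 : 1 < ρ) (hρ : ρ < radius T) {ε : ℝ} (hε : 0 < ε) :
    ∀ᶠ N : ℕ in atTop, ∀ a ∈ region jm jp ρ, ∑ ν ∈ badIndices jm jp T N, |weight N a ν| ≤ ε := by
  obtain ⟨θ, hθ, h⟩ := exists_sum_abs_weight_le hT hρ1 hρ
  have hlim : ∀ᶠ N : ℕ in atTop, θ ^ N < ε :=
    (tendsto_pow_atTop_nhds_zero_of_lt_one hθ.1 hθ.2).eventually_lt_const hε
  filter_upwards [hlim, eventually_gt_atTop 0] with N hN hN0 a ha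
  by_cases hp : jp
  · have hm : ¬jm := fun hm => hj ⟨hm, hp⟩
    have e : badIndices jm jp T N = {ν ∈ Finset.range (N + 1) | node N ν < T} := by
      ext ν; simp [badIndices, hp, hm]
    rw [e]
    exact (h N hN0 a ⟨ha.2.1 hp, (abs_le.1 ha.1).2⟩).trans hN.le
  by_cases hm : jm
  · have e : badIndices jm jp T N = {ν ∈ Finset.range (N + 1) | -T < node N ν} := by
      ext ν; simp [badIndices, hp, hm]
    rw [e, sum_abs_weight_neg hN0]
    have h1 := ha.2.2.1 hm
    have h2 := (abs_le.1 ha.1).1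
    exact (h N hN0 (-a) ⟨by linarith, by linarith⟩).trans hN.le
  · rw [badIndices_eq_empty (by tauto)]
    simpa using hε.le

theorem norm_sum_badIndices_le {jm jp : Prop} {T : ℝ} {N : ℕ} {a ε M : ℝ}
    (hb : ∑ ν ∈ badIndices jm jp T N, |weight N a ν| ≤ ε) {h : ℂ → ℂ}
    (hM : ∀ x ∈ unitSegment, ‖h x‖ ≤ M) :
    ‖∑ ν ∈ badIndices jm jp T N, (weight N a ν : ℂ) * h (node N ν)‖ ≤ ε * M := by
  have hM0 : 0 ≤ M := (norm_nonneg _).trans (hM 0 ⟨0, by norm_num, by simp⟩)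
  refine le_trans ?_ (mul_le_mul_of_nonneg_right hb hM0)
  rw [Finset.sum_mul]
  refine norm_sum_le_of_le _ fun ν hν => ?_
  rw [norm_mul, Complex.norm_real, Real.norm_eq_abs]
  gcongr
  exact hM _ (ofReal_mem_unitSegment.2 (node_mem_Icc (badIndices_subset _ _ _ _ hν)))

theorem sum_goodIndices (jm jp : Prop) (T : ℝ) (N : ℕ) (a : ℝ) (h : ℂ → ℂ) :
    ∑ ν ∈ goodIndices jm jp T N, (weight N a ν : ℂ) * h (node N ν) =
      bernsteinApply N a h - ∑ ν ∈ badIndices jm jp T N, (weight N a ν : ℂ) * h (node N ν) := by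
  rw [eq_sub_iff_add_eq, goodIndices, Finset.sum_sdiff (badIndices_subset jm jp T N)]
  rfl

/-- The functions of one complex variable that are holomorphic on the disc of radius `r`. -/
def discHol (r : ℝ) : Submodule ℂ (ℂ → ℂ) where
  carrier := {h | DifferentiableOn ℂ h (Metric.ball 0 r)}
  add_mem' hf hg := DifferentiableOn.add hf hg
  zero_mem' := differentiableOn_const 0
  smul_mem' c _ hf := DifferentiableOn.const_smul hf c

theorem unitSegment_subset_closedBall {ρ : ℝ} (hρ : 1 ≤ ρ) :
    unitSegment ⊆ Metric.closedBall 0 ρ := by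
  rintro _ ⟨t, ht, rfl⟩
  simpa using (abs_le.2 ht).trans hρ

/-- The full functional approximates evaluation and its bad part is negligible; each gets half of
`ε`. -/
theorem eventually_good_of_hol {jm jp : Prop} (hj : ¬(jm ∧ jp)) {T ρ ρ' : ℝ}
    (hT : T ∈ Ico (0 : ℝ) 1) (hρ1 : 1 < ρ) (hρ : ρ < ρ') (hρ' : ρ' < radius T) {ε : ℝ}
    (hε : 0 < ε) :
    ∀ᶠ N : ℕ in atTop, ∀ a ∈ region jm jp ρ, ∀ h ∈ discHol (radius T), ∀ M : ℝ,
      (∀ x ∈ Metric.closedBall 0 ρ', ‖h x‖ ≤ M) →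
      ‖∑ ν ∈ goodIndices jm jp T N, (weight N a ν : ℂ) * h (node N ν) - h a‖ ≤ ε * M := by
  obtain ⟨C, hN⟩ := exists_norm_bernsteinApply_sub_le hρ1.le hρ hρ'
  have hlim : ∀ᶠ N : ℕ in atTop, C / (N : ℝ) < ε / 2 :=
    (tendsto_const_div_atTop_nhds_zero_nat C).eventually_lt_const (half_pos hε)
  filter_upwards [hlim, eventually_gt_atTop 0, eventually_sum_badIndices_le hj hT hρ1
    (hρ.trans hρ') (half_pos hε)] with N h1 h2 h3 a ha h hh M hM
  have hM0 : 0 ≤ M := (norm_nonneg _).trans (hM 0 (by simp; linarith))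
  have h4 := hN N h2 a ha.1 h M hh hM
  have h5 := norm_sum_badIndices_le (h3 a ha)
    fun x hx => hM x (unitSegment_subset_closedBall (hρ1.trans hρ).le hx)
  rw [sum_goodIndices, sub_right_comm]
  refine (norm_sub_le _ _).trans ((add_le_add (h4.trans
    (mul_le_mul_of_nonneg_right h1.le hM0)) h5).trans (le_of_eq (by ring)))

open scoped Classical in
/-- The admissible functions of one variable: holomorphic if `P` holds, arbitrary otherwise. -/
def coordSpace (P : Prop) (r : ℝ) : Submodule ℂ (ℂ → ℂ) := if P then discHol r else ⊤

open scoped Classical in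
/-- The domain of one variable: a closed disc if `P` holds, the segment `[-1, 1]` otherwise. -/
def coordDomain (P : Prop) (ρ : ℝ) : Set ℂ := if P then Metric.closedBall 0 ρ else unitSegment

theorem unitSegment_subset_coordDomain (P : Prop) {ρ : ℝ} (hρ : 1 ≤ ρ) :
    unitSegment ⊆ coordDomain P ρ := by
  by_cases h : P <;> simp [coordDomain, h, unitSegment_subset_closedBall hρ]

theorem isCompact_unitSegment : IsCompact unitSegment :=
  isCompact_Icc.image Complex.continuous_ofReal

theorem isCompact_coordDomain (P : Prop) (ρ : ℝ) : IsCompact (coordDomain P ρ) := by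
  by_cases h : P <;> simp [coordDomain, h, isCompact_unitSegment, isCompact_closedBall]

theorem ofReal_mem_coordDomain {jm jp : Prop} {ρ ρ' a : ℝ} (hρ : ρ ≤ ρ') (ha : a ∈ region jm jp ρ) :
    (a : ℂ) ∈ coordDomain (jm ∨ jp) ρ' := by
  by_cases h : jm ∨ jp
  · simpa [coordDomain, h] using ha.1.trans hρ
  · simpa [coordDomain, h, ofReal_mem_unitSegment] using ha.2.2.2 h

theorem exists_normLEOn_good {jm jp : Prop} (hj : ¬(jm ∧ jp)) {T ρ ρ' : ℝ}
    (hT : T ∈ Ico (0 : ℝ) 1) (hρ1 : 1 < ρ) (hρ : ρ < ρ') (hρ' : ρ' < radius T) :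
    ∃ C : ℝ, 1 ≤ C ∧ ∀ᶠ N : ℕ in atTop, ∀ a ∈ region jm jp ρ,
      NormLEOn (coordSpace (jm ∨ jp) (radius T)) (coordDomain (jm ∨ jp) ρ') C
        (goodIndices jm jp T N) (fun ν => (weight N a ν : ℂ)) (fun ν => (node N ν : ℂ)) := by
  by_cases h : jm ∨ jp
  -- With error at most `M`, the functional is bounded by `‖f a‖ + M ≤ 2 * M`.
  · refine ⟨2, by norm_num, ?_⟩
    filter_upwards [eventually_good_of_hol hj hT hρ1 hρ hρ' one_pos] with N hN a ha f hf M hM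
    simp only [coordSpace, coordDomain, h, if_true] at hf hM
    have h1 := hN a ha f hf M hM
    have h2 := hM a (by simpa using ha.1.trans hρ.le)
    have h3 := norm_add_le _ _ |>.trans (add_le_add h1 h2)
    rw [sub_add_cancel] at h3
    linarith
  · refine ⟨1, le_rfl, Eventually.of_forall fun N a ha f _ M hM => ?_⟩
    simp only [coordDomain, h, if_false] at hM
    rw [goodIndices_eq_range h, one_mul]
    exact norm_bernsteinApply_le (ha.2.2.2 h) fun t ht => hM _ (ofReal_mem_unitSegment.2 ht)

/-! ### Estimates for the pieces of the multivariate sum -/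

section Tensor

variable {m : ℕ} {T ρ ρ' : Fin m → ℝ} {Jm Jp : Finset (Fin m)}

/-- The part of the Bernstein sum of `F` whose nodes are bad in the coordinates in `S` and good in
the other coordinates. -/
def partialSum (T : Fin m → ℝ) (Jm Jp S : Finset (Fin m)) (N : Fin m → ℕ+) (a : Fin m → ℝ)
    (F : (Fin m → ℂ) → ℂ) : ℂ :=
  tensorApply (fun j => if j ∈ S then badIndices (j ∈ Jm) (j ∈ Jp) (T j) (N j)
      else goodIndices (j ∈ Jm) (j ∈ Jp) (T j) (N j))
    (fun j ν => (weight (N j) (a j) ν : ℂ)) (fun j ν => (node (N j) ν : ℂ)) F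

theorem mem_mixedDomain_of_coordDomain {r : Fin m → ℝ} {J : Finset (Fin m)}
    (hρ' : ∀ j, ρ' j < r j) {w : Fin m → ℂ} (hw : ∀ j, w j ∈ coordDomain (j ∈ J) (ρ' j)) :
    w ∈ mixedDomain r J := by
  refine ⟨fun j hj => ?_, fun j hj => ?_⟩
  · have := hw j
    simp only [coordDomain, hj, if_true, mem_closedBall_zero_iff] at this
    exact this.trans_lt (hρ' j)
  · simpa only [coordDomain, hj, if_false] using hw j

theorem IsExtension.continuousOn_compact {R : Type*} [TopologicalSpace R] {r : Fin m → ℝ}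
    {φ : (Fin m → ℝ) × R → ℂ} {F : R → (Fin m → ℂ) → ℂ} (hF : IsExtension r T φ Jm Jp F)
    (hρ' : ∀ j, ρ' j < r j) (X : Set R) :
    ContinuousOn (fun p : R × (Fin m → ℂ) => F p.1 p.2)
      (X ×ˢ univ.pi fun j => coordDomain (j ∈ Jm ∪ Jp) (ρ' j)) :=
  hF.continuousOn.mono fun _ hp =>
    ⟨mem_univ _, mem_mixedDomain_of_coordDomain hρ' fun j => hp.2 j (mem_univ j)⟩

theorem IsExtension.exists_norm_le {R : Type*} [TopologicalSpace R] {r : Fin m → ℝ}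
    {φ : (Fin m → ℝ) × R → ℂ} {F : R → (Fin m → ℂ) → ℂ} (hF : IsExtension r T φ Jm Jp F)
    (hρ' : ∀ j, ρ' j < r j) {X : Set R} (hX : IsCompact X) :
    ∃ M : ℝ, 0 < M ∧
      ∀ x ∈ X, ∀ w, (∀ j, w j ∈ coordDomain (j ∈ Jm ∪ Jp) (ρ' j)) → ‖F x w‖ ≤ M := by
  obtain ⟨M, hM⟩ := (hX.prod (isCompact_univ_pi fun j => isCompact_coordDomain (j ∈ Jm ∪ Jp)
    (ρ' j))).exists_bound_of_continuousOn (hF.continuousOn_compact hρ' X)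
  exact ⟨max M 1, by positivity, fun x hx w hw =>
    (hM (x, w) ⟨hx, fun j _ => hw j⟩).trans (le_max_left _ _)⟩

theorem IsExtension.separatelyIn {R : Type*} [TopologicalSpace R] {r : Fin m → ℝ}
    {φ : (Fin m → ℝ) × R → ℂ} {F : R → (Fin m → ℂ) → ℂ} (hF : IsExtension r T φ Jm Jp F)
    (hρ' : ∀ j, ρ' j < r j) (x : R) :
    SeparatelyIn (fun j => coordSpace (j ∈ Jm ∪ Jp) (r j))
      (fun j => coordDomain (j ∈ Jm ∪ Jp) (ρ' j)) (F x) := by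
  intro w hw j
  by_cases hj : j ∈ Jm ∪ Jp
  · simp only [coordSpace, hj, if_true]
    exact hF.differentiableOn x w (mem_mixedDomain_of_coordDomain hρ' hw) j hj
  · simp only [coordSpace, hj, if_false]
    exact Submodule.mem_top

theorem node_mem_coordDomain {P : Prop} {ρ' : ℝ} (hρ' : 1 ≤ ρ') {N ν : ℕ}
    (hν : ν ∈ Finset.range (N + 1)) : (node N ν : ℂ) ∈ coordDomain P ρ' :=
  unitSegment_subset_coordDomain P hρ' (ofReal_mem_unitSegment.2 (node_mem_Icc hν))

theorem coordDomain_nonempty (P : Prop) {ρ' : ℝ} (hρ' : 1 ≤ ρ') : (coordDomain P ρ').Nonempty :=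
  ⟨_, node_mem_coordDomain hρ' (Finset.mem_range.2 (Nat.succ_pos 0))⟩

theorem eventually_norm_partialSum_le {R : Type*} [TopologicalSpace R]
    (hT : ∀ j, T j ∈ Ico (0 : ℝ) 1) (hJ : Disjoint Jm Jp) (hρ1 : ∀ j, 1 < ρ j)
    (hρ : ∀ j, ρ j < ρ' j) (hρ' : ∀ j, ρ' j < radius (T j)) {S : Finset (Fin m)}
    (hS : S.Nonempty) {φ : (Fin m → ℝ) × R → ℂ} {F : R → (Fin m → ℂ) → ℂ}
    (hF : IsExtension (fun j => radius (T j)) T φ (Jm \ S) (Jp \ S) F) {X : Set R}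
    (hX : IsCompact X) {ε : ℝ} (hε : 0 < ε) :
    ∀ᶠ N in minAtTop m, ∀ x ∈ X, ∀ a : Fin m → ℝ,
      (∀ j, a j ∈ region (j ∈ Jm) (j ∈ Jp) (ρ j)) → ‖partialSum T Jm Jp S N a (F x)‖ ≤ ε := by
  have hd : ∀ j, ¬(j ∈ Jm ∧ j ∈ Jp) := fun j h => Finset.disjoint_left.1 hJ h.1 h.2
  obtain ⟨M, hM0, hM⟩ := hF.exists_norm_le hρ' hX
  choose C hC1 hC using fun j => exists_normLEOn_good (hd j) (hT j) (hρ1 j) (hρ j) (hρ' j)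
  obtain ⟨j₀, hj₀⟩ := hS
  have hP : 0 < ∏ j, C j := Finset.prod_pos fun j _ => zero_lt_one.trans_le (hC1 j)
  -- One bad coordinate `j₀` supplies the small factor; in any other bad coordinate only `δ ≤ 1 ≤ C
  -- j` is used.
  obtain ⟨δ, hδ0, hδ1, hδ⟩ : ∃ δ : ℝ, 0 < δ ∧ δ ≤ 1 ∧ (∏ j, C j) * δ * M ≤ ε := by
    refine ⟨min 1 (ε / ((∏ j, C j) * M)), by positivity, min_le_left _ _, ?_⟩
    calc (∏ j, C j) * min 1 (ε / ((∏ j, C j) * M)) * M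
        ≤ (∏ j, C j) * (ε / ((∏ j, C j) * M)) * M := by
          gcongr
          exact min_le_right _ _
      _ = ε := by field_simp
  filter_upwards [eventually_minAtTop fun j => (hC j).and
    (eventually_sum_badIndices_le (hd j) (hT j) (hρ1 j) ((hρ j).trans (hρ' j)) hδ0)]
    with N hN x hx a ha
  have hprod : ∏ j, C j * (if j = j₀ then δ else 1) = (∏ j, C j) * δ := by
    rw [Finset.prod_mul_distrib, Finset.prod_ite_eq' Finset.univ j₀ fun _ => δ]
    simp
  refine le_trans ?_ hδ
  rw [← hprod]
  have hρ1' : ∀ j, 1 ≤ ρ' j := fun j => ((hρ1 j).trans (hρ j)).le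
  refine norm_tensorApply_le (fun j => coordDomain_nonempty _ (hρ1' j)) (fun j ν hν => ?_)
    (fun j => ?_) (hF.separatelyIn hρ' x) (hM x hx)
  · refine node_mem_coordDomain (hρ1' j) ?_
    by_cases hj : j ∈ S
    · simp only [hj, if_true] at hν
      exact badIndices_subset _ _ _ _ hν
    · simp only [hj, if_false] at hν
      exact goodIndices_subset _ _ _ _ hν
  · by_cases hj : j ∈ S
    · simp only [hj, if_true]
      intro h _ B hB
      have hB' : ∀ x ∈ unitSegment, ‖h x‖ ≤ B :=
        fun x hx => hB x (unitSegment_subset_coordDomain _ (hρ1' j) hx)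
      have hB0 : 0 ≤ B := (norm_nonneg _).trans (hB' 0 ⟨0, by norm_num, by simp⟩)
      refine (norm_sum_badIndices_le ((hN j).2 (a j) (ha j)) hB').trans
        (mul_le_mul_of_nonneg_right ?_ hB0)
      split_ifs
      · nlinarith [hC1 j]
      · linarith [hC1 j]
    · have hne : j ≠ j₀ := fun h => hj (h ▸ hj₀)
      have hiff : (j ∈ Jm \ S ∪ Jp \ S) = (j ∈ Jm ∨ j ∈ Jp) := by simp [hj]
      simp only [hj, if_false, hne, mul_one, hiff]
      exact (hN j).1 (a j) (ha j)

theorem dist_update_ofReal_lt {δ : ℝ} (hδ : 0 < δ) (w : Fin m → ℂ) (j : Fin m) {s t : ℝ}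
    (h : |s - t| < δ) :
    dist (Function.update w j (s : ℂ)) (Function.update w j (t : ℂ)) < δ := by
  refine (dist_pi_lt_iff hδ).2 fun i => ?_
  rcases eq_or_ne i j with rfl | hij
  · rw [Function.update_self, Function.update_self, Complex.dist_eq, ← Complex.ofReal_sub,
      Complex.norm_real, Real.norm_eq_abs]
    exact h
  · rw [Function.update_of_ne hij, Function.update_of_ne hij, dist_self]
    exact hδ

theorem eventually_norm_partialSum_empty_sub_le {R : Type*} [MetricSpace R]
    (hT : ∀ j, T j ∈ Ico (0 : ℝ) 1) (hJ : Disjoint Jm Jp) (hρ1 : ∀ j, 1 < ρ j)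
    (hρ : ∀ j, ρ j < ρ' j) (hρ' : ∀ j, ρ' j < radius (T j))
    {φ : (Fin m → ℝ) × R → ℂ} {F : R → (Fin m → ℂ) → ℂ}
    (hF : IsExtension (fun j => radius (T j)) T φ Jm Jp F) {X : Set R}
    (hX : IsCompact X) {ε : ℝ} (hε : 0 < ε) :
    ∀ᶠ N in minAtTop m, ∀ x ∈ X, ∀ a : Fin m → ℝ,
      (∀ j, a j ∈ region (j ∈ Jm) (j ∈ Jp) (ρ j)) →
      ‖partialSum T Jm Jp ∅ N a (F x) - F x fun j => a j‖ ≤ ε := by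
  have hd : ∀ j, ¬(j ∈ Jm ∧ j ∈ Jp) := fun j h => Finset.disjoint_left.1 hJ h.1 h.2
  have hiff : ∀ j, (j ∈ Jm ∪ Jp) = (j ∈ Jm ∨ j ∈ Jp) := by simp
  have hρ1' : ∀ j, 1 ≤ ρ' j := fun j => ((hρ1 j).trans (hρ j)).le
  obtain ⟨M, hM0, hM⟩ := hF.exists_norm_le hρ' hX
  choose C hC1 hC using fun j => exists_normLEOn_good (hd j) (hT j) (hρ1 j) (hρ j) (hρ' j)
  have hP : 0 < ∏ j, C j := Finset.prod_pos fun j _ => zero_lt_one.trans_le (hC1 j)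
  obtain ⟨η, hη0, hη⟩ : ∃ η : ℝ, 0 < η ∧ m * (∏ j, C j) * η ≤ ε := by
    refine ⟨ε / ((m + 1) * ∏ j, C j), by positivity, ?_⟩
    rw [mul_div_assoc', div_le_iff₀ (by positivity)]
    have : 0 ≤ ε * ∏ j, C j := by positivity
    linarith
  -- A modulus of continuity uniform in `x` and in all the other coordinates, needed for the
  -- coordinates without holomorphy.
  obtain ⟨δ, hδ0, hδ⟩ := Metric.uniformContinuousOn_iff.1
    ((hX.prod (isCompact_univ_pi fun j => isCompact_coordDomain (j ∈ Jm ∪ Jp)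
      (ρ' j))).uniformContinuousOn_of_continuous (hF.continuousOn_compact hρ' X)) _ (half_pos hη0)
  have hlim : ∀ᶠ n : ℕ in atTop, 2 * M / δ ^ 2 * (12 / (n : ℝ)) < η / 2 := by
    have := (tendsto_const_div_atTop_nhds_zero_nat (12 : ℝ)).const_mul (2 * M / δ ^ 2)
    rw [mul_zero] at this
    exact this.eventually_lt_const (half_pos hη0)
  filter_upwards [eventually_minAtTop fun j => (hC j).and (hlim.and (eventually_good_of_hol (hd j)
    (hT j) (hρ1 j) (hρ j) (hρ' j) (div_pos hη0 hM0)))] with N hN x hx a ha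
  refine le_trans ?_ hη
  have hupd : ∀ w : Fin m → ℂ, (∀ j, w j ∈ coordDomain (j ∈ Jm ∪ Jp) (ρ' j)) → ∀ j z,
      z ∈ coordDomain (j ∈ Jm ∪ Jp) (ρ' j) → ∀ i, Function.update w j z i ∈
        coordDomain (i ∈ Jm ∪ Jp) (ρ' i) := by
    intro w hw j z hz i
    rcases eq_or_ne i j with rfl | h
    · simpa using hz
    · simpa [Function.update_of_ne h] using hw i
  have haD : ∀ j, (a j : ℂ) ∈ coordDomain (j ∈ Jm ∪ Jp) (ρ' j) := by
    intro j
    rw [hiff]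
    exact ofReal_mem_coordDomain (hρ j).le (ha j)
  simp only [partialSum, Finset.notMem_empty, if_false]
  have hz : ∀ j, ∀ ν ∈ goodIndices (j ∈ Jm) (j ∈ Jp) (T j) (N j),
      (node (N j) ν : ℂ) ∈ coordDomain (j ∈ Jm ∪ Jp) (ρ' j) :=
    fun j ν hν => node_mem_coordDomain (hρ1' j) (goodIndices_subset _ _ _ _ hν)
  refine norm_tensorApply_sub_le (H := fun j => coordSpace (j ∈ Jm ∪ Jp) (radius (T j)))
    (D := fun j => coordDomain (j ∈ Jm ∪ Jp) (ρ' j)) (a := fun j => (a j : ℂ)) hC1 hz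
    (fun j => ?_) haD (hF.separatelyIn hρ' x) hη0.le fun w hw j => ?_
  · rw [hiff]
    exact (hN j).1 (a j) (ha j)
  · have hsec : ∀ z ∈ coordDomain (j ∈ Jm ∪ Jp) (ρ' j), ‖F x (Function.update w j z)‖ ≤ M :=
      fun z hz => hM x hx _ (hupd w hw j z hz)
    by_cases hj : j ∈ Jm ∪ Jp
    · have h1 := hF.separatelyIn hρ' x w hw j
      simp only [coordSpace, coordDomain, hj, if_true] at h1 hsec
      have h2 := (hN j).2.2 (a j) (ha j) _ h1 M hsec
      rwa [div_mul_cancel₀ _ hM0.ne'] at h2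
    · have hj' : ¬(j ∈ Jm ∨ j ∈ Jp) := by rwa [← hiff]
      have hseg : ∀ t ∈ Icc (-1 : ℝ) 1, (t : ℂ) ∈ coordDomain (j ∈ Jm ∪ Jp) (ρ' j) :=
        fun t ht => unitSegment_subset_coordDomain _ (hρ1' j) (ofReal_mem_unitSegment.2 ht)
      have haI := (ha j).2.2.2 hj'
      rw [goodIndices_eq_range hj']
      have hmod : ∀ t ∈ Icc (-1 : ℝ) 1, |t - a j| < δ →
          ‖F x (Function.update w j t) - F x (Function.update w j (a j))‖ ≤ η / 2 := by
        intro t ht hta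
        have hdist : dist (x, Function.update w j (t : ℂ))
            (x, Function.update w j (a j : ℂ)) < δ := by
          rw [Prod.dist_eq, dist_self]
          exact max_lt hδ0 (dist_update_ofReal_lt hδ0 w j hta)
        have := hδ _ ⟨hx, fun i _ => hupd w hw j t (hseg t ht) i⟩ _
          ⟨hx, fun i _ => hupd w hw j _ (haD j) i⟩ hdist
        rw [dist_eq_norm] at this
        exact this.le
      have key := norm_bernsteinApply_sub_le (h := fun z => F x (Function.update w j z))
        (N j).pos haI hδ0 (half_pos hη0).le (fun t ht => hsec t (hseg t ht)) hmod
      have hlast := (hN j).2.1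
      have : η / 2 + 2 * M / δ ^ 2 * (12 / ((N j : ℕ) : ℝ)) ≤ η := by linarith
      exact key.trans this

end Tensor

/-! ### Decomposition of the Bernstein sum and conclusion -/

theorem one_lt_radius {T : ℝ} (hT : T ∈ Ico (0 : ℝ) 1) : 1 < radius T := by
  have := (rho_spec hT).1
  unfold radius
  linarith

theorem bernsteinSum_eq_sum_partialSum {m : ℕ} {R : Type*} [TopologicalSpace R] {r T : Fin m → ℝ}
    (hr : ∀ j, 1 < r j) {φ : (Fin m → ℝ) × R → ℂ} {Jm Jp : Finset (Fin m)}
    {F : Finset (Fin m) → R → (Fin m → ℂ) → ℂ}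
    (hF : ∀ S, IsExtension r T φ (Jm \ S) (Jp \ S) (F S)) (N : Fin m → ℕ+) (a : Fin m → ℝ) (x : R) :
    bernsteinSum φ N (a, x) = ∑ S, partialSum T Jm Jp S N a (F S x) := by
  classical
  -- The node tuples are fibred over their set of bad coordinates. On the fibre over `S` the
  -- threshold inequalities hold for the coordinates in `Jm \ S` and `Jp \ S`, so `F S` takes the
  -- values of φ there.
  let g : (Fin m → ℕ) → Finset (Fin m) := fun ν =>
    {j | ν j ∈ badIndices (j ∈ Jm) (j ∈ Jp) (T j) (N j)}
  rw [bernsteinSum, ← Finset.sum_fiberwise _ g]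
  refine Finset.sum_congr rfl fun S _ => ?_
  have hS : {ν ∈ Fintype.piFinset fun j => Finset.range ((N j : ℕ) + 1) | g ν = S} =
      Fintype.piFinset fun j => if j ∈ S then badIndices (j ∈ Jm) (j ∈ Jp) (T j) (N j)
        else goodIndices (j ∈ Jm) (j ∈ Jp) (T j) (N j) := by
    ext ν
    simp only [Finset.mem_filter, Fintype.mem_piFinset, Finset.ext_iff, g, Finset.mem_univ,
      true_and, ← forall_and]
    refine forall_congr' fun j => ?_
    by_cases hj : j ∈ S
    · simp only [hj, iff_true, if_true]
      exact ⟨fun h => h.2, fun h => ⟨badIndices_subset _ _ _ _ h, h⟩⟩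
    · simp only [hj, iff_false, if_false, goodIndices, Finset.mem_sdiff]
  rw [hS, partialSum, tensorApply]
  refine Finset.sum_congr (by congr!) fun ν hν => ?_
  rw [Fintype.mem_piFinset] at hν
  have hrange : ∀ j, ν j ∈ Finset.range ((N j : ℕ) + 1) := by
    intro j
    have := hν j
    split_ifs at this
    · exact badIndices_subset _ _ _ _ this
    · exact goodIndices_subset _ _ _ _ this
  have hgood : ∀ j ∉ S, ¬((j ∈ Jp ∧ node (N j) (ν j) < T j) ∨
      (j ∈ Jm ∧ -T j < node (N j) (ν j))) := by
    intro j hj h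
    have := hν j
    simp only [hj, if_false, goodIndices, Finset.mem_sdiff] at this
    exact this.2 (by simpa [badIndices, this.1] using h)
  have hnode := fun j => node_mem_Icc (hrange j)
  rw [(hF S).eq_of_mem x (fun j => node (N j) (ν j))
    (fun j => ⟨by linarith [(hnode j).1, hr j], by linarith [(hnode j).2, hr j]⟩)
    (fun j hj => ?_) (fun j hj => ?_) fun j _ => hnode j, Complex.ofReal_prod]
  · rfl
  · rw [Finset.mem_sdiff] at hj
    exact not_lt.1 fun h => hgood j hj.2 (Or.inr ⟨hj.1, h⟩)
  · rw [Finset.mem_sdiff] at hj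
    exact not_lt.1 fun h => hgood j hj.2 (Or.inl ⟨hj.1, h⟩)

theorem eventually_norm_bernsteinSum_sub_le {m : ℕ} {R : Type*} [MetricSpace R]
    {T ρ ρ' : Fin m → ℝ} {Jm Jp : Finset (Fin m)} (hT : ∀ j, T j ∈ Ico (0 : ℝ) 1)
    (hJ : Disjoint Jm Jp) (hρ1 : ∀ j, 1 < ρ j) (hρ : ∀ j, ρ j < ρ' j)
    (hρ' : ∀ j, ρ' j < radius (T j)) {φ : (Fin m → ℝ) × R → ℂ}
    {F : Finset (Fin m) → R → (Fin m → ℂ) → ℂ}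
    (hF : ∀ S, IsExtension (fun j => radius (T j)) T φ (Jm \ S) (Jp \ S) (F S)) {X : Set R}
    (hX : IsCompact X) {ε : ℝ} (hε : 0 < ε) :
    ∀ᶠ N in minAtTop m, ∀ x ∈ X, ∀ a : Fin m → ℝ,
      (∀ j, a j ∈ region (j ∈ Jm) (j ∈ Jp) (ρ j)) → ‖bernsteinSum φ N (a, x) - φ (a, x)‖ ≤ ε := by
  have hr : ∀ j, 1 < radius (T j) := fun j => one_lt_radius (hT j)
  obtain ⟨κ, hκ⟩ : ∃ κ : ℝ, κ = (Finset.univ : Finset (Finset (Fin m))).card := ⟨_, rfl⟩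
  have hκ0 : 0 < κ := by
    rw [hκ]
    exact_mod_cast Finset.card_pos.2 Finset.univ_nonempty
  have hF0 : IsExtension (fun j => radius (T j)) T φ Jm Jp (F ∅) := by simpa using hF ∅
  have hev : ∀ S : Finset (Fin m), ∀ᶠ N in minAtTop m, ∀ x ∈ X, ∀ a : Fin m → ℝ,
      (∀ j, a j ∈ region (j ∈ Jm) (j ∈ Jp) (ρ j)) →
      ‖partialSum T Jm Jp S N a (F S x) - if S = ∅ then φ (a, x) else 0‖ ≤ ε / κ := by
    intro S
    rcases S.eq_empty_or_nonempty with rfl | hS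
    · filter_upwards [eventually_norm_partialSum_empty_sub_le hT hJ hρ1 hρ hρ' hF0 hX
        (div_pos hε hκ0)] with N hN x hx a ha
      rw [if_pos rfl, ← hF0.eq_of_mem x a]
      · exact hN x hx a ha
      · intro j
        have h1 := abs_le.1 (ha j).1
        exact ⟨by linarith [h1.1, hρ j, hρ' j], by linarith [h1.2, hρ j, hρ' j]⟩
      · exact fun j hj => ((ha j).2.2.1 hj).trans (by linarith [(hT j).2])
      · exact fun j hj => le_trans (by linarith [(hT j).2]) ((ha j).2.1 hj)
      · exact fun j hj => (ha j).2.2.2 (by simpa using hj)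
    · filter_upwards [eventually_norm_partialSum_le hT hJ hρ1 hρ hρ' hS (hF S) hX
        (div_pos hε hκ0)] with N hN x hx a ha
      rw [if_neg hS.ne_empty, sub_zero]
      exact hN x hx a ha
  filter_upwards [eventually_all.2 hev] with N hN x hx a ha
  -- The target is carried entirely by `S = ∅`; the other pieces must tend to 0.
  have e : φ (a, x) = ∑ S : Finset (Fin m), if S = ∅ then φ (a, x) else 0 := by simp
  rw [bernsteinSum_eq_sum_partialSum hr hF, e, ← Finset.sum_sub_distrib]
  refine (norm_sum_le_of_le _ fun S _ => hN S x hx a ha).trans (le_of_eq ?_)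
  rw [Finset.sum_const, nsmul_eq_mul, ← hκ]
  field_simp

theorem exists_radius_bounds {m : ℕ} {R : Type*} [TopologicalSpace R] {r : Fin m → ℝ}
    (hr : ∀ j, 1 < r j) {K : Set ((Fin m → ℝ) × R)} (hK : IsCompact K)
    (hKsub : K ⊆ box r ×ˢ univ) :
    ∃ ρ : Fin m → ℝ, (∀ j, 1 < ρ j) ∧ (∀ j, ρ j < r j) ∧ ∀ p ∈ K, ∀ j, |p.1 j| ≤ ρ j := by
  have : ∀ j, ∃ t, 1 < t ∧ t < r j ∧ ∀ p ∈ K, |p.1 j| ≤ t := by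
    intro j
    rcases K.eq_empty_or_nonempty with rfl | hne
    · obtain ⟨t, h1, h2⟩ := exists_between (hr j)
      exact ⟨t, h1, h2, by simp⟩
    · obtain ⟨p, hp, hmax⟩ := hK.exists_isMaxOn hne
        (Continuous.continuousOn (by fun_prop : Continuous fun p : (Fin m → ℝ) × R => |p.1 j|))
      have hlt : max 1 |p.1 j| < r j := max_lt (hr j) (abs_lt.2 ((hKsub hp).1 j))
      obtain ⟨t, h1, h2⟩ := exists_between hlt
      exact ⟨t, (le_max_left _ _).trans_lt h1, h2, fun q hq =>
        (hmax hq).trans ((le_max_right _ _).trans h1.le)⟩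
  choose ρ h1 h2 h3 using this
  exact ⟨ρ, h1, h2, fun p hp j => h3 j p hp⟩

end BernsteinPoly

end

theorem lemma4p2 {m : ℕ} (hm : 1 ≤ m) {R : Type*} [MetricSpace R]
    (T : Fin m → ℝ) (hT : ∀ j, T j ∈ Ico (0 : ℝ) 1)
    (φ : (Fin m → ℝ) × R → ℂ)
    (hφ : ContinuousOn φ (BernsteinPoly.box (fun j => BernsteinPoly.radius (T j)) ×ˢ univ))
    (hhol : ∀ Jm Jp : Finset (Fin m), Disjoint Jm Jp → (Jm ∪ Jp).Nonempty →
      ∃ f : {α : ↥(Jm ∪ Jp)ᶜ → ℝ // ∀ j, α j ∈ Icc (-1 : ℝ) 1} × R →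
          BernsteinPoly.Hol
            (BernsteinPoly.polydisc (fun j : ↥(Jm ∪ Jp) => BernsteinPoly.radius (T j))),
        Continuous f ∧
        ∀ (x : R) (a : Fin m → ℝ)
          (ha : a ∈ BernsteinPoly.box (fun j => BernsteinPoly.radius (T j))),
          (∀ j ∈ Jm, a j ≤ -T j) → (∀ j ∈ Jp, T j ≤ a j) →
          ∀ hJ' : ∀ j : ↥(Jm ∪ Jp)ᶜ, a j ∈ Icc (-1 : ℝ) 1,
            φ (a, x) = (f (⟨fun j => a j, hJ'⟩, x)).1
              (BernsteinPoly.restrictBox (Jm ∪ Jp) a ha))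
    (K : Set ((Fin m → ℝ) × R)) (hK : IsCompact K)
    (hKsub : K ⊆ BernsteinPoly.box (fun j => BernsteinPoly.radius (T j)) ×ˢ univ) :
    TendstoUniformlyOn (BernsteinPoly.bernsteinSum φ) φ (BernsteinPoly.minAtTop m) K := by
  classical
  have hr : ∀ j, 1 < BernsteinPoly.radius (T j) := fun j => BernsteinPoly.one_lt_radius (hT j)
  obtain ⟨ρ, hρ1, hρr, hρK⟩ := BernsteinPoly.exists_radius_bounds hr hK hKsub
  choose ρ' hρ hρ' using fun j => exists_between (hρr j)
  have hext : ∀ Jm Jp : Finset (Fin m), Disjoint Jm Jp →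
      ∃ F, BernsteinPoly.IsExtension (fun j => BernsteinPoly.radius (T j)) T φ Jm Jp F := by
    intro Jm Jp hJ
    rcases (Jm ∪ Jp).eq_empty_or_nonempty with h | h
    · obtain ⟨rfl, rfl⟩ := Finset.union_eq_empty.1 h
      exact ⟨_, BernsteinPoly.isExtension_empty hr hφ⟩
    · exact BernsteinPoly.exists_isExtension (hhol Jm Jp hJ h)
  rw [Metric.tendstoUniformlyOn_iff]
  intro ε hε
  -- There are finitely many sign patterns, so one eventual set of `N` serves all of them and hence
  -- every point of `K`.
  have hev : ∀ q : Finset (Fin m) × Finset (Fin m), ∀ᶠ N in BernsteinPoly.minAtTop m,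
      Disjoint q.1 q.2 → ∀ x ∈ Prod.snd '' K, ∀ a : Fin m → ℝ,
      (∀ j, a j ∈ BernsteinPoly.region (j ∈ q.1) (j ∈ q.2) (ρ j)) →
      ‖BernsteinPoly.bernsteinSum φ N (a, x) - φ (a, x)‖ ≤ ε / 2 := by
    rintro ⟨Jm, Jp⟩
    by_cases hJ : Disjoint Jm Jp
    · choose F hF using fun S => hext (Jm \ S) (Jp \ S)
        (hJ.mono Finset.sdiff_subset Finset.sdiff_subset)
      filter_upwards [BernsteinPoly.eventually_norm_bernsteinSum_sub_le hT hJ hρ1 hρ hρ' hF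
        (hK.image continuous_snd) (half_pos hε)] with N hN _
      exact hN
    · exact Eventually.of_forall fun N h => absurd h hJ
  filter_upwards [eventually_all.2 hev] with N hN p hp
  have h := hN (Finset.univ.filter fun j => p.1 j < -1, Finset.univ.filter fun j => 1 < p.1 j)
    (Finset.disjoint_left.2 fun j h1 h2 => by
      simp only [Finset.mem_filter, Finset.mem_univ, true_and] at h1 h2
      linarith) p.2 ⟨p, hp, rfl⟩ p.1 fun j => by
      simp only [Finset.mem_filter, Finset.mem_univ, true_and]
      refine ⟨hρK p hp j, le_of_lt, le_of_lt, fun h => ?_⟩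
      rw [not_or, not_lt, not_lt] at h
      exact h
  rw [dist_comm, dist_eq_norm]
  exact h.trans_lt (half_lt_self hε)
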